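/- Let $d\ge 2$ and $\beta\ge 1$ be integers, let $\sigma$ be the surface (spherical Lebesgue) measure on the unit sphere $S^{d-1}\subset\mathbb R^d$, $|S^{d-1}|=\sigma(S^{d-1})$, and let $U$ be uniformly distributed on $S^{d-1}$. Put $$\psi_d(\beta)=\mathbb E\,(b^\top U)^\beta\quad(\text{independent of } b\in S^{d-1}),\qquad \rho_\beta(b,c)=\mathbb E\big[(b^\top U)^\beta (c^\top U)^\beta\big]-\psi_d(\beta)^2,\qquad b,c\in S^{d-1}.$$ Let $L^2=L^2(S^{d-1},\sigma;\mathbb K)$ with $\mathbb K=\mathbb R$ or $\mathbb K=\mathbb C$, and let $K_\beta:L^2\to L^2$ be the bounded operator $$K_\beta f(x)=\frac1{|S^{d-1}|}\int_{S^{d-1}}\rho_\beta(\omega,x)f(\omega)\,d\sigma(\omega).$$ For $k\in\mathbb N_0$ let $\mathcal H_k$ be the space of ($\mathbb K$-valued) spherical harmonics of order $k$, i.e. of restrictions to $S^{d-1}$ of homogeneous harmonic polynomials of degree $k$ in $d$ variables, and let $\nu_d(k)$ be its dimension (the same for $\mathbb R$ and $\mathbb C$). Let $P_k^d$ be the $d$-dimensional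 Legendre polynomial of order $k$, i.e. the unique real polynomial with $\sum_{i=1}^{\nu_d(k)}\phi_i(u)\phi_i(v)=\frac{\nu_d(k)}{|S^{d-1}|}P_k^d(u^\top v)$, $u,v\in S^{d-1}$, for every orthonormal basis $\phi_1,\dots,\phi_{\nu_d(k)}$ of the space of real spherical harmonics of order $k$ in $L^2(S^{d-1},\sigma;\mathbb R)$. Let $c_{0,d}(\beta),\dots,c_{\beta,d}(\beta)$ be the unique real numbers with $t^\beta=\sum_{j=0}^\beta c_{j,d}(\beta)P_j^d(t)$ for all $t\in[-1,1]$. Set $$\lambda_k=\Big(\frac{c_{k,d}(\beta)}{\nu_d(k)}\Big)^2\ \text{ for } 0<k\le\beta,\qquad \lambda_k=0\ \text{ for } k=0 \text{ or } k>\beta .$$ Then: (i) for every $k\in\mathbb N_0$ and every $\phi\in\mathcal H_k$, $K_\beta\phi=\lambda_k\phi$ (pointwise at every $x\in S^{d-1}$, and in $L^2$); (ii) $K_\beta$ is a finite-rank operator; (iii) every $\lambda_k$, $k\in\mathbb N_0$, is an eigenvalue of $K_\beta$, and the spectrum of $K_\beta$ is $\{0\}\cup\{\lambda_k: 0<k\le\beta\}$;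 (iv) $K_\beta$ is positive: for all $f\in L^2$ the number $\langle K_\beta f,f\rangle_{L^2}$ is real and nonnegative. -/

import Mathlib

open MeasureTheory Polynomial

noncomputable section

namespace SphereKernel

/-- The unit sphere `S^{d-1}` of `ℝ^d`. -/
abbrev Sph (d : ℕ) : Type := Metric.sphere (0 : EuclideanSpace ℝ (Fin d)) 1

/-- The spherical Lebesgue (surface) measure `σ` on `S^{d-1}`. -/
abbrev sigma (d : ℕ) : Measure (Sph d) :=
  (volume : Measure (EuclideanSpace ℝ (Fin d))).toSphere

/-- The total surface area `|S^{d-1}|`. -/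
def area (d : ℕ) : ℝ := (sigma d).real Set.univ

/-- The Euclidean scalar product `bᵀ c` of two points of the sphere. -/
def dot {d : ℕ} (b c : Sph d) : ℝ :=
  inner ℝ (b : EuclideanSpace ℝ (Fin d)) (c : EuclideanSpace ℝ (Fin d))

/-- `E f(U)` for `U` uniformly distributed on the sphere. -/
def uniformMean (d : ℕ) (f : Sph d → ℝ) : ℝ := (area d)⁻¹ * ∫ ω, f ω ∂(sigma d)

/-- `ψ_d(β) = E (bᵀ U)^β`, which does not depend on `b`; here `b` is the first standard basis
vector. -/
def psi (d β : ℕ) : ℝ :=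
  if h : 0 < d then uniformMean d (fun ω => ((ω : EuclideanSpace ℝ (Fin d)) ⟨0, h⟩) ^ β) else 0

/-- `η_β(b, c) = E (bᵀ U)^β (cᵀ U)^β`. -/
def eta (d β : ℕ) (b c : Sph d) : ℝ := uniformMean d (fun ω => dot b ω ^ β * dot c ω ^ β)

/-- The covariance kernel `ρ_β(b, c) = η_β(b, c) - ψ_d(β)²`. -/
def rho (d β : ℕ) (b c : Sph d) : ℝ := eta d β b c - psi d β ^ 2

/-! ### Spherical harmonics -/

section Harmonics

variable (𝕜 : Type*) [RCLike 𝕜]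

/-- The Laplacian on polynomials in `d` variables. -/
def polyLaplacian (d : ℕ) : MvPolynomial (Fin d) 𝕜 →ₗ[𝕜] MvPolynomial (Fin d) 𝕜 :=
  ∑ i : Fin d, (MvPolynomial.pderiv i).toLinearMap ∘ₗ (MvPolynomial.pderiv i).toLinearMap

/-- Homogeneous harmonic polynomials of degree `k` in `d` variables. -/
def harmonicPoly (d k : ℕ) : Submodule 𝕜 (MvPolynomial (Fin d) 𝕜) :=
  MvPolynomial.homogeneousSubmodule (Fin d) 𝕜 k ⊓ LinearMap.ker (polyLaplacian 𝕜 d)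

/-- Restriction of a polynomial to the unit sphere. -/
def restrictSphere (d : ℕ) : MvPolynomial (Fin d) 𝕜 →ₗ[𝕜] C(Sph d, 𝕜) where
  toFun p :=
    ⟨fun x => MvPolynomial.eval (fun i => (((x : EuclideanSpace ℝ (Fin d)) i : ℝ) : 𝕜)) p, by
      have h := MvPolynomial.continuous_eval p
      refine h.comp (continuous_pi fun i => ?_)
      exact RCLike.continuous_ofReal.comp (by fun_prop)⟩
  map_add' p q := by ext x; simp
  map_smul' a p := by ext x; simp

/-- The space `H_k(S^{d-1})` of (`𝕜`-valued) spherical harmonics of order `k`. -/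
def sphericalHarmonics (d k : ℕ) : Submodule 𝕜 C(Sph d, 𝕜) :=
  (harmonicPoly 𝕜 d k).map (restrictSphere 𝕜 d)

end Harmonics

/-- `ν_d(k) = dim H_k(S^{d-1})`. -/
def nu (d k : ℕ) : ℕ := Module.finrank ℝ (sphericalHarmonics ℝ d k)

/-- `φ` is an orthonormal basis of `H_k(S^{d-1})` in `L²(S^{d-1}, σ)`. -/
def IsHarmonicONB (d k : ℕ) (φ : Fin (nu d k) → C(Sph d, ℝ)) : Prop :=
  (∀ i j, ∫ ω, φ i ω * φ j ω ∂(sigma d) = if i = j then 1 else 0) ∧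
    Submodule.span ℝ (Set.range φ) = sphericalHarmonics ℝ d k

/-- The defining property of the `d`-dimensional Legendre polynomial of order `k`: for every
orthonormal basis `φ` of `H_k(S^{d-1})`,
`∑ i, φ_i(u) φ_i(v) = ν_d(k) / |S^{d-1}| * P (uᵀ v)` on the sphere. -/
def IsLegendre (d k : ℕ) (P : ℝ[X]) : Prop :=
  ∀ φ : Fin (nu d k) → C(Sph d, ℝ), IsHarmonicONB d k φ →
    ∀ u v : Sph d, ∑ i, φ i u * φ i v = (nu d k : ℝ) / area d * P.eval (dot u v)

/-- The `d`-dimensional Legendre polynomial `P_k^d` of order `k` (for `d ≥ 2`, the unique polynomial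
with the defining property). -/
def legendreP (d k : ℕ) : ℝ[X] := Classical.epsilon (IsLegendre d k)

/-- `c` is the sequence of coefficients in `t^m = ∑_{j=0}^m c_j P_j^d(t)`, `t ∈ [-1,1]`. -/
def IsLegendreExpansion (d m : ℕ) (c : ℕ → ℝ) : Prop :=
  (∀ t ∈ Set.Icc (-1 : ℝ) 1,
      t ^ m = ∑ j ∈ Finset.range (m + 1), c j * (legendreP d j).eval t) ∧
    ∀ j, m < j → c j = 0

/-- The coefficients `c_{j,d}(m)` of the expansion of `t^m` in the Legendre polynomials `P_j^d`
(for `d ≥ 2`, the unique coefficient sequence). -/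
def legendreCoeff (d m : ℕ) : ℕ → ℝ := Classical.epsilon (IsLegendreExpansion d m)

/-- `λ_k = (c_{k,d}(β) / ν_d(k))²` for `0 < k ≤ β`, and `λ_k = 0` for `k = 0` or `k > β`. -/
def eigval (d β k : ℕ) : ℝ :=
  if 0 < k ∧ k ≤ β then (legendreCoeff d β k / (nu d k : ℝ)) ^ 2 else 0

/-! ### The integral operator -/

section Operator

variable {𝕜 : Type*} [RCLike 𝕜]

/-- `x ↦ |S^{d-1}|⁻¹ ∫ ρ_β(ω, x) f(ω) dσ(ω)`. -/
def kernelInt (d β : ℕ) (f : Sph d → 𝕜) (x : Sph d) : 𝕜 :=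
  (((area d)⁻¹ : ℝ) : 𝕜) * ∫ ω, (rho d β ω x : 𝕜) * f ω ∂(sigma d)

lemma continuous_rho (d β : ℕ) : Continuous (fun p : Sph d × Sph d => rho d β p.1 p.2) := by
  unfold rho eta uniformMean dot
  refine (continuous_const.mul ?_).sub continuous_const
  have h : Continuous (Function.uncurry fun (p : Sph d × Sph d) (ω : Sph d) =>
      (inner ℝ (p.1 : EuclideanSpace ℝ (Fin d)) (ω : EuclideanSpace ℝ (Fin d)) : ℝ) ^ β *
      (inner ℝ (p.2 : EuclideanSpace ℝ (Fin d)) (ω : EuclideanSpace ℝ (Fin d)) : ℝ) ^ β) := by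
    unfold Function.uncurry
    fun_prop
  have h2 := continuous_parametric_integral_of_continuous (μ := sigma d) h isCompact_univ
  simpa only [Measure.restrict_univ] using h2

lemma exists_rho_bound (d β : ℕ) : ∃ C : ℝ, 0 ≤ C ∧ ∀ ω x : Sph d, |rho d β ω x| ≤ C := by
  obtain ⟨C, hC⟩ := isCompact_univ.exists_bound_of_continuousOn (continuous_rho d β).continuousOn
  exact ⟨max C 0, le_max_right _ _, fun ω x =>
    le_trans (by simpa using hC (ω, x) (Set.mem_univ _)) (le_max_left _ _)⟩

lemma integrable_rho_mul (d β : ℕ) {f : Sph d → 𝕜} (hf : Integrable f (sigma d)) (x : Sph d) :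
    Integrable (fun ω => (rho d β ω x : 𝕜) * f ω) (sigma d) := by
  obtain ⟨C, _, hC⟩ := exists_rho_bound d β
  refine hf.bdd_mul (c := C) ?_ (Filter.Eventually.of_forall fun ω => by simpa using hC ω x)
  exact (RCLike.continuous_ofReal.comp
    ((continuous_rho d β).comp (by fun_prop : Continuous fun ω : Sph d => (ω, x)))
    ).aestronglyMeasurable

lemma continuous_kernelInt (d β : ℕ) {f : Sph d → 𝕜} (hf : Integrable f (sigma d)) :
    Continuous (kernelInt d β f) := by
  obtain ⟨C, _, hC⟩ := exists_rho_bound d β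
  unfold kernelInt
  refine continuous_const.mul ?_
  refine continuous_of_dominated (F := fun (x ω : Sph d) => (rho d β ω x : 𝕜) * f ω)
    (bound := fun ω => C * ‖f ω‖)
    (fun x => (integrable_rho_mul d β hf x).aestronglyMeasurable) ?_ (hf.norm.const_mul C) ?_
  · intro x
    refine Filter.Eventually.of_forall fun ω => ?_
    rw [norm_mul]
    exact mul_le_mul_of_nonneg_right (by simpa using hC ω x) (norm_nonneg _)
  · refine Filter.Eventually.of_forall fun ω => ?_
    have h2 : Continuous fun x : Sph d => (ω, x) := by fun_prop
    have h3 : Continuous fun x : Sph d => rho d β ω x := by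
      have h := (continuous_rho d β).comp h2
      simpa only [Function.comp_def] using h
    have h4 : Continuous fun x : Sph d => (rho d β ω x : 𝕜) := RCLike.continuous_ofReal.comp h3
    exact h4.mul continuous_const

lemma integrable_coe {d : ℕ} (f : Lp 𝕜 2 (sigma d)) : Integrable f (sigma d) :=
  (Lp.memLp f).integrable (by norm_num)

lemma memLp_kernelInt (d β : ℕ) (f : Lp 𝕜 2 (sigma d)) :
    MemLp (kernelInt d β f) 2 (sigma d) := by
  have h := continuous_kernelInt d β (integrable_coe f)
  obtain ⟨C, hC⟩ := isCompact_univ.exists_bound_of_continuousOn h.continuousOn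
  exact MemLp.of_bound h.aestronglyMeasurable C
    (Filter.Eventually.of_forall fun x => hC x (Set.mem_univ _))

lemma exists_norm_kernelInt_le (d β : ℕ) : ∃ C : ℝ, 0 ≤ C ∧
    ∀ (f : Lp 𝕜 2 (sigma d)) (x : Sph d), ‖kernelInt d β f x‖ ≤ C * ‖f‖ := by
  obtain ⟨C, hC0, hC⟩ := exists_rho_bound d β
  refine ⟨|(area d)⁻¹| * (C * (area d) ^ (1 / 2 : ℝ)),
    mul_nonneg (abs_nonneg _) (mul_nonneg hC0 (Real.rpow_nonneg measureReal_nonneg _)),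
    fun f x => ?_⟩
  have hL1 : ∫ ω, ‖f ω‖ ∂(sigma d) ≤ (area d) ^ (1 / 2 : ℝ) * ‖f‖ := by
    have h1 := eLpNorm_le_eLpNorm_mul_rpow_measure_univ (p := 1) (q := 2) (μ := sigma d)
      (by norm_num) (Lp.aestronglyMeasurable f)
    have hfin : eLpNorm f 2 (sigma d) ≠ ⊤ := Lp.eLpNorm_ne_top f
    have h2 := ENNReal.toReal_mono (ENNReal.mul_ne_top hfin
      (ENNReal.rpow_ne_top_of_nonneg (by norm_num) (measure_ne_top _ _))) h1
    rw [ENNReal.toReal_mul, ← ENNReal.toReal_rpow] at h2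
    rw [integral_norm_eq_lintegral_enorm (Lp.aestronglyMeasurable f), ← eLpNorm_one_eq_lintegral_enorm]
    refine h2.trans (le_of_eq ?_)
    rw [mul_comm, Lp.norm_def]
    norm_num [area, Measure.real]
  unfold kernelInt
  rw [norm_mul, RCLike.norm_ofReal, mul_assoc]
  refine mul_le_mul_of_nonneg_left ?_ (abs_nonneg _)
  calc ‖∫ ω, (rho d β ω x : 𝕜) * f ω ∂(sigma d)‖
      ≤ ∫ ω, ‖(rho d β ω x : 𝕜) * f ω‖ ∂(sigma d) := norm_integral_le_integral_norm _
    _ ≤ ∫ ω, C * ‖f ω‖ ∂(sigma d) := by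
        refine integral_mono (integrable_rho_mul d β (integrable_coe f) x).norm
          ((integrable_coe f).norm.const_mul C) fun ω => ?_
        simp only [norm_mul]
        exact mul_le_mul_of_nonneg_right (by simpa using hC ω x) (norm_nonneg _)
    _ = C * ∫ ω, ‖f ω‖ ∂(sigma d) := integral_const_mul _ _
    _ ≤ C * (area d ^ (1 / 2 : ℝ) * ‖f‖) := mul_le_mul_of_nonneg_left hL1 hC0
    _ = C * area d ^ (1 / 2 : ℝ) * ‖f‖ := by ring

variable (𝕜)

/-- `K_β` as a linear map of `L²(S^{d-1}, σ)`. -/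
def kernelLin (d β : ℕ) : Lp 𝕜 2 (sigma d) →ₗ[𝕜] Lp 𝕜 2 (sigma d) where
  toFun f := (memLp_kernelInt d β f).toLp (kernelInt d β f)
  map_add' f g := by
    rw [← MemLp.toLp_add]
    refine MemLp.toLp_congr _ _ (Filter.Eventually.of_forall fun x => ?_)
    simp only [kernelInt, Pi.add_apply]
    rw [← mul_add, ← integral_add (integrable_rho_mul d β (integrable_coe f) x)
      (integrable_rho_mul d β (integrable_coe g) x)]
    congr 1
    refine integral_congr_ae ?_
    filter_upwards [Lp.coeFn_add f g] with ω hω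
    rw [hω, Pi.add_apply, mul_add]
  map_smul' a f := by
    rw [RingHom.id_apply, ← MemLp.toLp_const_smul]
    refine MemLp.toLp_congr _ _ (Filter.Eventually.of_forall fun x => ?_)
    simp only [kernelInt, Pi.smul_apply, smul_eq_mul]
    rw [mul_left_comm a, ← integral_const_mul a]
    congr 1
    refine integral_congr_ae ?_
    filter_upwards [Lp.coeFn_smul a f] with ω hω
    rw [hω, Pi.smul_apply, smul_eq_mul, mul_left_comm]

lemma kernelLin_bound (d β : ℕ) :
    ∃ C : ℝ, ∀ f : Lp 𝕜 2 (sigma d), ‖kernelLin 𝕜 d β f‖ ≤ C * ‖f‖ := by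
  obtain ⟨C, hC0, hC⟩ := exists_norm_kernelInt_le (𝕜 := 𝕜) d β
  refine ⟨(sigma d).real Set.univ ^ ((2 : ENNReal).toReal)⁻¹ * C, fun f => ?_⟩
  rw [mul_assoc]
  refine Lp.norm_le_of_ae_bound (mul_nonneg hC0 (norm_nonneg _)) ?_
  filter_upwards [(memLp_kernelInt d β f).coeFn_toLp] with x hx
  exact (congrArg norm hx).le.trans (hC f x)

/-- The operator `K_β f (x) = |S^{d-1}|⁻¹ ∫ ρ_β(ω, x) f(ω) dσ(ω)` as a bounded operator on
`L²(S^{d-1}, σ)`. -/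
def opK (d β : ℕ) : Lp 𝕜 2 (sigma d) →L[𝕜] Lp 𝕜 2 (sigma d) :=
  (kernelLin 𝕜 d β).mkContinuousOfExistsBound (kernelLin_bound 𝕜 d β)

lemma opK_coe (d β : ℕ) (f : Lp 𝕜 2 (sigma d)) :
    opK 𝕜 d β f =ᵐ[sigma d] kernelInt d β f :=
  (memLp_kernelInt d β f).coeFn_toLp

end Operator

end SphereKernel

end

/-!
The operator `K_β` is diagonalised by the spherical harmonics because its kernel is a combination of
their reproducing kernels.

Everything rests on the reproducing property of the zonal harmonics, and this is obtained without
rotations, from Gaussian integration by parts. By polar coordinates, the integral of a homogeneous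
polynomial over the sphere is a nonzero multiple of its integral against `e^{-|x|²/2}`
(`gaussInt_eq_radialMoment_mul`), and for the latter multiplication by `x_i` may be replaced by
`∂_i` (`gaussInt_X_mul`). For `p`, `q` harmonic of degrees `k`, `l`, Euler's identity then gives
`k ∫ p q = ∫ ∇p · ∇q = l ∫ p q`, hence the orthogonality of spherical harmonics of different orders
(`integral_mul_sphericalHarmonics_eq_zero`). In the same way, a harmonic `q` of degree `k` is
orthogonal to `(vᵀ x)^m` for `m < k`, and `∫ (vᵀ x)^k q` is a constant times `q(v)`
(`integral_dot_pow_mul_eq_zero`, `integral_dot_pow_mul_self`).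

An explicit recursion provides harmonic polynomials `∑_j g_j |x|^{2j} (vᵀ x)^{k-2j}` with `g_0 = 1`
(`zonalPoly_mem_harmonicPoly`). On the sphere such a polynomial is `G_k(uᵀ v)` with `G_k` monic of
degree `k`, and pairing it with a harmonic of order `k` only sees the leading power, so that
`G_k(uᵀ v)` is a multiple of the reproducing kernel of the harmonics of order `k`
(`integral_zonalProfile_mul`). Expanding it in an orthonormal basis is the addition theorem
(`sum_harmonicONB_mul`); it shows that the Legendre polynomials exist and are multiples of the
`G_k`, and, these being monic, that every `t^m` has a Legendre expansion.

Inserting the expansion of `t^β` into the definition of `ρ_β` and integrating products of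
reproducing kernels yields `ρ_β = |S^{d-1}| ∑_{0 < j ≤ β} λ_j Z_j` with `Z_j` the reproducing kernel
of order `j`; the term of order `0` is exactly `ψ_d(β)²` (`rho_eq_sum`). The eigenvalue equation
follows from the reproducing property, finite rank and positivity from the expansion of `Z_j` in an
orthonormal basis (`opK_eq_sum`), and the spectrum from the fact that `X ∏_j (X - λ_j)` annihilates
`K_β` (`aeval_opK_prod`).
-/

namespace SphereKernel

/-! ### Gaussian integrals of polynomials and integrals over the sphere -/

section Gaussian

variable {𝕜 : Type*} [RCLike 𝕜] {d : ℕ}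

/-- The value of a polynomial with coefficients in `𝕜` at a point of `ℝ^d`. -/
noncomputable def evalAt (p : MvPolynomial (Fin d) 𝕜) (x : EuclideanSpace ℝ (Fin d)) : 𝕜 :=
  MvPolynomial.eval (fun i => ((x i : ℝ) : 𝕜)) p

/-- The unnormalised Gaussian density `e^{-|x|²/2}`. -/
noncomputable def gaussWeight (x : EuclideanSpace ℝ (Fin d)) : ℝ := Real.exp (-(1 / 2) * ‖x‖ ^ 2)

@[simp] lemma evalAt_add (p q : MvPolynomial (Fin d) 𝕜) (x : EuclideanSpace ℝ (Fin d)) :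
    evalAt (p + q) x = evalAt p x + evalAt q x := by simp [evalAt]

@[simp] lemma evalAt_mul (p q : MvPolynomial (Fin d) 𝕜) (x : EuclideanSpace ℝ (Fin d)) :
    evalAt (p * q) x = evalAt p x * evalAt q x := by simp [evalAt]

@[simp] lemma evalAt_smul (a : 𝕜) (q : MvPolynomial (Fin d) 𝕜) (x : EuclideanSpace ℝ (Fin d)) :
    evalAt (a • q) x = a * evalAt q x := by simp [evalAt]

@[simp] lemma evalAt_X (i : Fin d) (x : EuclideanSpace ℝ (Fin d)) :
    evalAt (MvPolynomial.X i : MvPolynomial (Fin d) 𝕜) x = (x i : 𝕜) := by simp [evalAt]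

lemma continuous_evalAt (p : MvPolynomial (Fin d) 𝕜) : Continuous (evalAt p) := by
  refine (MvPolynomial.continuous_eval p).comp (continuous_pi fun i => ?_)
  exact RCLike.continuous_ofReal.comp (by fun_prop)

lemma continuous_gaussWeight : Continuous (gaussWeight (d := d)) := by
  unfold gaussWeight; fun_prop

lemma gaussWeight_pos (x : EuclideanSpace ℝ (Fin d)) : 0 < gaussWeight x := Real.exp_pos _

/-- A homogeneous polynomial scales along rays; only real factors `r` are needed. -/
lemma evalAt_smul_of_isHomogeneous {n : ℕ} {p : MvPolynomial (Fin d) 𝕜} (hp : p.IsHomogeneous n)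
    (r : ℝ) (x : EuclideanSpace ℝ (Fin d)) : evalAt p (r • x) = (r : 𝕜) ^ n * evalAt p x := by
  unfold evalAt
  rw [MvPolynomial.eval_eq, MvPolynomial.eval_eq, Finset.mul_sum]
  refine Finset.sum_congr rfl fun s hs => ?_
  rw [hp.degree_eq_sum_deg_support hs]
  simp only [PiLp.smul_apply, smul_eq_mul, map_mul, mul_pow, Finset.prod_mul_distrib,
    Finset.prod_pow_eq_pow_sum]
  simp only [RCLike.algebraMap_eq_ofReal]
  ring

lemma norm_evalAt_monomial_le (s : Fin d →₀ ℕ) (a : 𝕜) (x : EuclideanSpace ℝ (Fin d)) :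
    ‖evalAt (MvPolynomial.monomial s a) x‖ ≤ ‖a‖ * ‖x‖ ^ (∑ i, s i) := by
  simp only [evalAt, MvPolynomial.eval_monomial, norm_mul]
  rw [Finsupp.prod_fintype _ _ (by simp), ← Finset.prod_pow_eq_pow_sum, norm_prod]
  refine mul_le_mul_of_nonneg_left (Finset.prod_le_prod (fun _ _ => norm_nonneg _) fun i _ => ?_)
    (norm_nonneg _)
  rw [norm_pow, RCLike.norm_ofReal]
  exact pow_le_pow_left₀ (abs_nonneg _) (by simpa using PiLp.norm_apply_le x i) _

lemma integrable_norm_pow_mul_gaussWeight (hd : 1 ≤ d) (n : ℕ) :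
    Integrable (fun x : EuclideanSpace ℝ (Fin d) => ‖x‖ ^ n * gaussWeight x) := by
  have : Nonempty (Fin d) := ⟨⟨0, hd⟩⟩
  unfold gaussWeight
  refine (integrable_fun_norm_addHaar
    (f := fun r : ℝ => r ^ n * Real.exp (-(1 / 2) * r ^ 2)) volume).2 ?_
  refine (integrableOn_rpow_mul_exp_neg_mul_sq (b := 1 / 2) (by norm_num)
    (s := ((d - 1 + n : ℕ) : ℝ)) (by
      have : (0 : ℝ) ≤ ((d - 1 + n : ℕ) : ℝ) := Nat.cast_nonneg _
      linarith)).congr_fun (fun x _ => ?_) measurableSet_Ioi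
  simp only [Real.rpow_natCast, finrank_euclideanSpace, Fintype.card_fin, smul_eq_mul]
  ring

lemma integrable_gaussWeight_smul_evalAt (hd : 1 ≤ d) (p : MvPolynomial (Fin d) 𝕜) :
    Integrable (fun x => gaussWeight x • evalAt p x) := by
  induction p using MvPolynomial.induction_on' with
  | monomial s a =>
    refine ((integrable_norm_pow_mul_gaussWeight hd (∑ i, s i)).const_mul ‖a‖).mono'
      (continuous_gaussWeight.smul (continuous_evalAt _)).aestronglyMeasurable
      (Filter.Eventually.of_forall fun x => ?_)
    rw [norm_smul, Real.norm_of_nonneg (gaussWeight_pos x).le]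
    have := mul_le_mul_of_nonneg_left (norm_evalAt_monomial_le s a x) (gaussWeight_pos x).le
    linarith
  | add p q hp hq => simpa only [evalAt_add, smul_add, Pi.add_def] using hp.add hq

lemma hasLineDerivAt_evalAt (p : MvPolynomial (Fin d) 𝕜) (i : Fin d)
    (x : EuclideanSpace ℝ (Fin d)) :
    HasLineDerivAt ℝ (evalAt p) (evalAt (MvPolynomial.pderiv i p) x) x
      (EuclideanSpace.single i (1 : ℝ)) := by
  unfold HasLineDerivAt
  induction p using MvPolynomial.induction_on with
  | C a => simpa [evalAt] using hasDerivAt_const (0 : ℝ) a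
  | add p q hp hq => simpa only [evalAt_add, map_add, Pi.add_def] using hp.add hq
  | mul_X p j hp =>
    have hX : HasDerivAt (fun t : ℝ => (((x + t • EuclideanSpace.single i (1 : ℝ)) j : ℝ) : 𝕜))
        (evalAt (MvPolynomial.pderiv i (MvPolynomial.X j)) x) 0 := by
      have h1 : HasDerivAt (fun t : ℝ => (x + t • EuclideanSpace.single i (1 : ℝ)) j)
          (if j = i then 1 else 0) 0 := by
        have := (((hasDerivAt_id (0 : ℝ)).mul_const
          ((EuclideanSpace.single i (1 : ℝ) : EuclideanSpace ℝ (Fin d)) j)).const_add (x j))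
        simpa [Pi.single_apply] using this
      have h2 := (RCLike.ofRealCLM (K := 𝕜)).hasFDerivAt.comp_hasDerivAt (0 : ℝ) h1
      have e : evalAt (MvPolynomial.pderiv i (MvPolynomial.X j : MvPolynomial (Fin d) 𝕜)) x
          = RCLike.ofRealCLM (K := 𝕜) (if j = i then (1 : ℝ) else 0) := by
        rw [MvPolynomial.pderiv_X, evalAt]
        by_cases h : j = i
        · subst h; simp
        · simp [h]
      rw [e]
      exact h2
    have h := hp.mul hX
    have e : evalAt (MvPolynomial.pderiv i (p * MvPolynomial.X j)) x
        = evalAt (MvPolynomial.pderiv i p) x *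
            (((x + (0 : ℝ) • EuclideanSpace.single i (1 : ℝ)) j : ℝ) : 𝕜)
          + evalAt p (x + (0 : ℝ) • EuclideanSpace.single i (1 : ℝ)) *
            evalAt (MvPolynomial.pderiv i (MvPolynomial.X j)) x := by
      rw [Derivation.leibniz]
      simp only [smul_eq_mul, evalAt_add, evalAt_mul, evalAt_X, zero_smul, add_zero]
      ring
    rw [e]
    simpa only [evalAt_mul, evalAt_X, Pi.mul_def] using h

lemma hasLineDerivAt_gaussWeight (i : Fin d) (x : EuclideanSpace ℝ (Fin d)) :
    HasLineDerivAt ℝ gaussWeight (-(x i) * gaussWeight x) x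
      (EuclideanSpace.single i (1 : ℝ)) := by
  have h1 : HasFDerivAt (fun y : EuclideanSpace ℝ (Fin d) => ‖y‖ ^ 2) (2 • innerSL ℝ x) x :=
    (hasStrictFDerivAt_norm_sq x).hasFDerivAt
  have h2 := ((h1.const_mul (-(1 / 2) : ℝ)).exp).hasLineDerivAt (EuclideanSpace.single i (1 : ℝ))
  have e : -(x i) * gaussWeight x
      = (Real.exp (-(1 / 2) * ‖x‖ ^ 2) • -(1 / 2 : ℝ) • 2 • innerSL ℝ x)
        (EuclideanSpace.single i (1 : ℝ)) := by
    simp [gaussWeight, EuclideanSpace.inner_single_right]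
    ring
  rw [e]
  exact h2

/-- The Gaussian integral `∫ e^{-|x|²/2} p(x) dx` of a polynomial (unnormalised). The hypothesis
`1 ≤ d` is only used for integrability, which additivity requires. -/
noncomputable def gaussInt (hd : 1 ≤ d) : MvPolynomial (Fin d) 𝕜 →ₗ[𝕜] 𝕜 where
  toFun p := ∫ x, gaussWeight x • evalAt p x
  map_add' p q := by
    simp only [evalAt_add, smul_add]
    exact integral_add (integrable_gaussWeight_smul_evalAt hd p)
      (integrable_gaussWeight_smul_evalAt hd q)
  map_smul' a p := by
    simp only [evalAt_smul, ← smul_eq_mul, smul_comm _ a, RingHom.id_apply]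
    exact integral_smul a _

/-- Gaussian integration by parts (Stein's identity). -/
lemma gaussInt_X_mul (hd : 1 ≤ d) (i : Fin d) (p : MvPolynomial (Fin d) 𝕜) :
    gaussInt hd (MvPolynomial.X i * p) = gaussInt hd (MvPolynomial.pderiv i p) := by
  have e : ∀ x : EuclideanSpace ℝ (Fin d), (-(x i) * gaussWeight x) • evalAt p x
      = -(gaussWeight x • evalAt (MvPolynomial.X i * p) x) := by
    intro x
    rw [evalAt_mul, evalAt_X, RCLike.real_smul_eq_coe_mul, RCLike.real_smul_eq_coe_mul]
    push_cast
    ring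
  have h := integral_bilinear_hasLineDerivAt_right_eq_neg_left_of_integrable
    (μ := (volume : Measure (EuclideanSpace ℝ (Fin d))))
    (f := gaussWeight) (f' := fun x => -(x i) * gaussWeight x)
    (g := evalAt p) (g' := evalAt (MvPolynomial.pderiv i p)) (v := EuclideanSpace.single i (1 : ℝ))
    (B := ContinuousLinearMap.lsmul ℝ ℝ)
    (by
      simp only [ContinuousLinearMap.lsmul_apply, e]
      exact (integrable_gaussWeight_smul_evalAt hd _).neg)
    (by simpa using integrable_gaussWeight_smul_evalAt hd _)
    (by simpa using integrable_gaussWeight_smul_evalAt hd _)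
    (fun x _ => hasLineDerivAt_gaussWeight i x) (fun x _ => hasLineDerivAt_evalAt p i x)
  simp only [ContinuousLinearMap.lsmul_apply, e, integral_neg, neg_neg] at h
  exact h.symm

/-- The total mass `∫ e^{-|x|²/2} dx` of the unnormalised Gaussian weight. -/
noncomputable def gaussMass (d : ℕ) : ℝ := ∫ x : EuclideanSpace ℝ (Fin d), gaussWeight x

lemma gaussInt_one (hd : 1 ≤ d) :
    gaussInt hd (1 : MvPolynomial (Fin d) 𝕜) = (gaussMass d : 𝕜) := by
  rw [gaussMass, ← integral_ofReal]
  simp [gaussInt, evalAt, RCLike.real_smul_eq_coe_mul]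

lemma integral_norm_pow_mul_gaussWeight_pos (hd : 1 ≤ d) (n : ℕ) :
    0 < ∫ x : EuclideanSpace ℝ (Fin d), ‖x‖ ^ n * gaussWeight x := by
  rw [integral_pos_iff_support_of_nonneg
    (fun x => mul_nonneg (by positivity) (gaussWeight_pos x).le)
    (integrable_norm_pow_mul_gaussWeight hd n)]
  have hsub : ({0}ᶜ : Set (EuclideanSpace ℝ (Fin d))) ⊆
      Function.support fun x : EuclideanSpace ℝ (Fin d) => ‖x‖ ^ n * gaussWeight x := by
    intro x hx
    exact mul_ne_zero (pow_ne_zero _ (norm_ne_zero_iff.2 hx)) (gaussWeight_pos x).ne'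
  refine lt_of_lt_of_le ?_ (measure_mono hsub)
  have : Nonempty (Fin d) := ⟨⟨0, hd⟩⟩
  exact isOpen_compl_singleton.measure_pos _ (exists_ne 0)

lemma gaussMass_pos (hd : 1 ≤ d) : 0 < gaussMass d := by
  simpa [gaussMass] using integral_norm_pow_mul_gaussWeight_pos hd 0

/-- Integration in polar coordinates of a function that is the product of a spherical and a
radial factor. -/
lemma integral_polar {h : Sph d → 𝕜} {g : ℝ → 𝕜}
    {F : EuclideanSpace ℝ (Fin d) → 𝕜} (hd : 1 ≤ d)
    (hF : ∀ (ω : Sph d) (r : ℝ), 0 < r →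
      F (r • (ω : EuclideanSpace ℝ (Fin d))) = h ω * g r) :
    ∫ x, F x = (∫ ω, h ω ∂(sigma d)) *
      ∫ r : Set.Ioi (0 : ℝ), g r ∂(Measure.volumeIoiPow (d - 1)) := by
  have : Nonempty (Fin d) := ⟨⟨0, hd⟩⟩
  set μ : Measure (EuclideanSpace ℝ (Fin d)) := volume
  have hdim : Module.finrank ℝ (EuclideanSpace ℝ (Fin d)) - 1 = d - 1 := by simp
  calc ∫ x, F x ∂μ
      = ∫ x : ({(0)}ᶜ : Set (EuclideanSpace ℝ (Fin d))), F x.1 ∂(μ.comap (↑)) := by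
        rw [integral_subtype_comap (measurableSet_singleton _).compl F,
          restrict_compl_singleton]
    _ = ∫ x, h x.1 * g x.2 ∂μ.toSphere.prod (.volumeIoiPow (d - 1)) := by
        rw [← hdim, ← μ.measurePreserving_homeomorphUnitSphereProd.integral_comp
          (Homeomorph.measurableEmbedding _) (fun x => h x.1 * g x.2)]
        refine integral_congr_ae (Filter.Eventually.of_forall fun x => ?_)
        simp only
        rw [← hF _ _ (homeomorphUnitSphereProd _ x).2.2]
        congr 1
        have hx : ‖(x : EuclideanSpace ℝ (Fin d))‖ ≠ 0 := norm_ne_zero_iff.2 x.2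
        simp [smul_smul, hx]
    _ = _ := integral_prod_mul h fun r : Set.Ioi (0 : ℝ) => g r

/-- The radial factor `∫_0^∞ r^n e^{-r²/2} r^{d-1} dr`; the density `r^{d-1}` is part of the measure
`volumeIoiPow (d - 1)`. -/
noncomputable def radialMoment (d n : ℕ) : ℝ :=
  ∫ r : Set.Ioi (0 : ℝ), (r : ℝ) ^ n * Real.exp (-(1 / 2) * (r : ℝ) ^ 2)
    ∂(Measure.volumeIoiPow (d - 1))

lemma norm_smul_sphere (ω : Sph d) {r : ℝ} (hr : 0 < r) :
    ‖r • (ω : EuclideanSpace ℝ (Fin d))‖ = r := by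
  rw [norm_smul, Real.norm_of_nonneg hr.le]; simp

/-- The radial factor is nonzero because `∫ |x|^n e^{-|x|²/2} dx` is positive. -/
lemma radialMoment_ne_zero (hd : 1 ≤ d) (n : ℕ) : radialMoment d n ≠ 0 := by
  have h1 := integral_polar (𝕜 := ℝ) (h := fun _ : Sph d => 1)
    (g := fun r => r ^ n * Real.exp (-(1 / 2) * r ^ 2))
    (F := fun x => ‖x‖ ^ n * gaussWeight x) hd (fun ω r hr => by
      simp only [gaussWeight, norm_smul_sphere ω hr, one_mul])
  intro h0
  rw [radialMoment] at h0
  rw [h0, mul_zero] at h1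
  exact (integral_norm_pow_mul_gaussWeight_pos hd n).ne' h1

lemma restrictSphere_apply (p : MvPolynomial (Fin d) 𝕜) (ω : Sph d) :
    restrictSphere 𝕜 d p ω = evalAt p ω := rfl

/-- On homogeneous polynomials of a fixed degree, the Gaussian integral is a nonzero multiple of
the integral over the sphere. -/
lemma gaussInt_eq_radialMoment_mul (hd : 1 ≤ d) {n : ℕ} {p : MvPolynomial (Fin d) 𝕜}
    (hp : p.IsHomogeneous n) :
    gaussInt hd p = (radialMoment d n : 𝕜) * ∫ ω, restrictSphere 𝕜 d p ω ∂(sigma d) := by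
  rw [mul_comm, radialMoment, ← integral_ofReal]
  refine integral_polar
    (g := fun r => ((r ^ n * Real.exp (-(1 / 2) * r ^ 2) : ℝ) : 𝕜)) hd fun ω r hr => ?_
  rw [evalAt_smul_of_isHomogeneous hp, gaussWeight, norm_smul_sphere ω hr,
    RCLike.real_smul_eq_coe_mul, restrictSphere_apply]
  push_cast
  ring

end Gaussian

/-! ### Harmonic polynomials and powers of linear forms -/

section Algebra

variable {𝕜 : Type*} [RCLike 𝕜] {d : ℕ}

lemma polyLaplacian_apply (p : MvPolynomial (Fin d) 𝕜) :
    polyLaplacian 𝕜 d p = ∑ i, MvPolynomial.pderiv i (MvPolynomial.pderiv i p) := by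
  simp [polyLaplacian, LinearMap.sum_apply]

lemma mem_harmonicPoly {k : ℕ} {p : MvPolynomial (Fin d) 𝕜} :
    p ∈ harmonicPoly 𝕜 d k ↔ p.IsHomogeneous k ∧ polyLaplacian 𝕜 d p = 0 := by
  simp [harmonicPoly, MvPolynomial.mem_homogeneousSubmodule]

lemma pderiv_comm (i j : Fin d) (p : MvPolynomial (Fin d) 𝕜) :
    MvPolynomial.pderiv i (MvPolynomial.pderiv j p)
      = MvPolynomial.pderiv j (MvPolynomial.pderiv i p) := by
  have h : ⁅(MvPolynomial.pderiv i :
      Derivation 𝕜 (MvPolynomial (Fin d) 𝕜) (MvPolynomial (Fin d) 𝕜)),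
      (MvPolynomial.pderiv j : Derivation 𝕜 (MvPolynomial (Fin d) 𝕜) (MvPolynomial (Fin d) 𝕜))⁆
      = 0 := by
    refine MvPolynomial.derivation_ext fun l => ?_
    have h0 : ∀ a b : Fin d, MvPolynomial.pderiv a (MvPolynomial.pderiv b
        (MvPolynomial.X l : MvPolynomial (Fin d) 𝕜)) = 0 := by
      intro a b
      rw [MvPolynomial.pderiv_X]
      by_cases h : l = b
      · subst h; simp
      · simp [h]
    rw [Derivation.commutator_apply, h0, h0]
    simp
  have h2 := DFunLike.congr_fun h p
  rw [Derivation.commutator_apply] at h2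
  exact sub_eq_zero.1 h2

/-- Euler's identity `k p = ∑ x_i ∂_i p` and integration by parts turn `k ∫ p q` into
`∫ ∇p · ∇q + ∫ (Δp) q`, and `Δp = 0`. -/
lemma gaussInt_euler (hd : 1 ≤ d) {k : ℕ} {p : MvPolynomial (Fin d) 𝕜} (hp : p ∈ harmonicPoly 𝕜 d k)
    (q : MvPolynomial (Fin d) 𝕜) :
    (k : 𝕜) * gaussInt hd (p * q)
      = ∑ i, gaussInt hd (MvPolynomial.pderiv i p * MvPolynomial.pderiv i q) := by
  obtain ⟨hh, hΔ⟩ := mem_harmonicPoly.1 hp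
  have h1 : (k : 𝕜) * gaussInt hd (p * q)
      = ∑ i, gaussInt hd (MvPolynomial.X i * (MvPolynomial.pderiv i p * q)) := by
    rw [← map_sum, ← smul_eq_mul, ← map_smul, ← smul_mul_assoc, Nat.cast_smul_eq_nsmul,
      ← hh.sum_X_mul_pderiv, Finset.sum_mul]
    simp only [mul_assoc]
  have h2 : ∀ i, gaussInt hd (MvPolynomial.X i * (MvPolynomial.pderiv i p * q))
      = gaussInt hd (MvPolynomial.pderiv i p * MvPolynomial.pderiv i q)
        + gaussInt hd (MvPolynomial.pderiv i (MvPolynomial.pderiv i p) * q) := by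
    intro i
    rw [gaussInt_X_mul, Derivation.leibniz, map_add, smul_eq_mul, smul_eq_mul, mul_comm q]
  rw [h1, Finset.sum_congr rfl fun i _ => h2 i, Finset.sum_add_distrib, ← map_sum (gaussInt hd)
    (fun i => MvPolynomial.pderiv i (MvPolynomial.pderiv i p) * q), ← Finset.sum_mul,
    ← polyLaplacian_apply, hΔ]
  simp

/-- Green's identity for the Gaussian weight: both `k ∫ p q` and `l ∫ p q` equal `∫ ∇p · ∇q`. -/
lemma gaussInt_mul_eq_zero (hd : 1 ≤ d) {k l : ℕ} (hkl : k ≠ l) {p q : MvPolynomial (Fin d) 𝕜}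
    (hp : p ∈ harmonicPoly 𝕜 d k) (hq : q ∈ harmonicPoly 𝕜 d l) : gaussInt hd (p * q) = 0 := by
  have h1 := gaussInt_euler hd hp q
  have h2 := gaussInt_euler hd hq p
  rw [mul_comm q p] at h2
  simp only [mul_comm (MvPolynomial.pderiv _ q)] at h2
  rw [← h1] at h2
  by_contra h
  exact hkl (by exact_mod_cast (mul_right_cancel₀ h h2).symm)

/-- Spherical harmonics of different orders are orthogonal. -/
lemma integral_mul_sphericalHarmonics_eq_zero (hd : 1 ≤ d) {k l : ℕ} (hkl : k ≠ l)
    {f g : C(Sph d, 𝕜)} (hf : f ∈ sphericalHarmonics 𝕜 d k) (hg : g ∈ sphericalHarmonics 𝕜 d l) :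
    ∫ ω, f ω * g ω ∂(sigma d) = 0 := by
  obtain ⟨p, hp, rfl⟩ := hf
  obtain ⟨q, hq, rfl⟩ := hg
  have h := gaussInt_eq_radialMoment_mul hd
    ((mem_harmonicPoly.1 hp).1.mul (mem_harmonicPoly.1 hq).1)
  rw [gaussInt_mul_eq_zero hd hkl hp hq] at h
  have h2 := (mul_eq_zero.1 h.symm).resolve_left
    (by exact_mod_cast radialMoment_ne_zero hd (k + l))
  simpa [restrictSphere_apply] using h2

/-- The linear form `x ↦ vᵀ x`. -/
noncomputable def linForm (𝕜 : Type*) [RCLike 𝕜] (v : EuclideanSpace ℝ (Fin d)) :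
    MvPolynomial (Fin d) 𝕜 :=
  ∑ i, MvPolynomial.C (v i : 𝕜) * MvPolynomial.X i

/-- The derivative of polynomials in the direction `v`. -/
noncomputable def dirDeriv (v : EuclideanSpace ℝ (Fin d)) (p : MvPolynomial (Fin d) 𝕜) :
    MvPolynomial (Fin d) 𝕜 :=
  ∑ i, MvPolynomial.C (v i : 𝕜) * MvPolynomial.pderiv i p

lemma evalAt_sum {ι : Type*} (s : Finset ι) (p : ι → MvPolynomial (Fin d) 𝕜)
    (x : EuclideanSpace ℝ (Fin d)) : evalAt (∑ i ∈ s, p i) x = ∑ i ∈ s, evalAt (p i) x := by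
  simp [evalAt]

@[simp] lemma evalAt_C (a : 𝕜) (x : EuclideanSpace ℝ (Fin d)) :
    evalAt (MvPolynomial.C a) x = a := by simp [evalAt]

@[simp] lemma evalAt_pow (p : MvPolynomial (Fin d) 𝕜) (n : ℕ) (x : EuclideanSpace ℝ (Fin d)) :
    evalAt (p ^ n) x = evalAt p x ^ n := by simp [evalAt]

lemma evalAt_linForm (u v : Sph d) :
    evalAt (linForm 𝕜 (v : EuclideanSpace ℝ (Fin d))) u = (dot u v : 𝕜) := by
  simp [linForm, evalAt_sum, dot, PiLp.inner_apply]

lemma isHomogeneous_linForm (v : EuclideanSpace ℝ (Fin d)) : (linForm 𝕜 v).IsHomogeneous 1 :=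
  MvPolynomial.IsHomogeneous.sum _ _ _ fun i _ => by
    simpa using (MvPolynomial.isHomogeneous_X 𝕜 i).C_mul (v i : 𝕜)

lemma pderiv_linForm (v : EuclideanSpace ℝ (Fin d)) (i : Fin d) :
    MvPolynomial.pderiv i (linForm 𝕜 v) = MvPolynomial.C (v i : 𝕜) := by
  simp [linForm, MvPolynomial.pderiv_X, Pi.single_apply]

lemma sum_sq_sphere (v : Sph d) :
    ∑ i, (((v : EuclideanSpace ℝ (Fin d)) i : ℝ) : 𝕜) ^ 2 = 1 := by
  have h : ‖(v : EuclideanSpace ℝ (Fin d))‖ ^ 2 = 1 := by simp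
  rw [EuclideanSpace.norm_sq_eq] at h
  simp only [Real.norm_eq_abs, sq_abs] at h
  exact_mod_cast congrArg (fun r : ℝ => (r : 𝕜)) h

lemma dirDeriv_linForm_pow_mul (v : Sph d) (m : ℕ) (q : MvPolynomial (Fin d) 𝕜) :
    dirDeriv v (linForm 𝕜 (v : EuclideanSpace ℝ (Fin d)) ^ (m + 1) * q)
      = ((m + 1 : ℕ) : 𝕜) • (linForm 𝕜 (v : EuclideanSpace ℝ (Fin d)) ^ m * q)
        + linForm 𝕜 (v : EuclideanSpace ℝ (Fin d)) ^ (m + 1) * dirDeriv v q := by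
  have hsq : ∑ i, (MvPolynomial.C (((v : EuclideanSpace ℝ (Fin d)) i : ℝ) : 𝕜) :
      MvPolynomial (Fin d) 𝕜) ^ 2 = 1 := by
    have h := congrArg (MvPolynomial.C (σ := Fin d)) (sum_sq_sphere (𝕜 := 𝕜) v)
    rw [map_sum, MvPolynomial.C_1] at h
    rw [← h]
    exact Finset.sum_congr rfl fun i _ => (map_pow MvPolynomial.C _ _).symm
  set ℓ := linForm 𝕜 (v : EuclideanSpace ℝ (Fin d)) with hℓ
  have h : ∀ i, MvPolynomial.C (((v : EuclideanSpace ℝ (Fin d)) i : ℝ) : 𝕜) *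
      MvPolynomial.pderiv i (ℓ ^ (m + 1) * q)
      = MvPolynomial.C (((v : EuclideanSpace ℝ (Fin d)) i : ℝ) : 𝕜) ^ 2 *
          (((m + 1 : ℕ) : 𝕜) • (ℓ ^ m * q))
        + ℓ ^ (m + 1) * (MvPolynomial.C (((v : EuclideanSpace ℝ (Fin d)) i : ℝ) : 𝕜) *
          MvPolynomial.pderiv i q) := by
    intro i
    rw [Derivation.leibniz, Derivation.leibniz_pow, hℓ, pderiv_linForm, Nat.cast_smul_eq_nsmul]
    simp only [smul_eq_mul, nsmul_eq_mul, Nat.add_sub_cancel]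
    ring
  rw [dirDeriv, Finset.sum_congr rfl fun i _ => h i, Finset.sum_add_distrib, ← Finset.sum_mul,
    hsq, one_mul, ← Finset.mul_sum, dirDeriv]

lemma gaussInt_linForm_mul (hd : 1 ≤ d) (v : EuclideanSpace ℝ (Fin d))
    (p : MvPolynomial (Fin d) 𝕜) :
    gaussInt hd (linForm 𝕜 v * p) = gaussInt hd (dirDeriv v p) := by
  simp only [linForm, dirDeriv, Finset.sum_mul, map_sum, MvPolynomial.C_mul', map_smul,
    gaussInt_X_mul, smul_mul_assoc]

lemma dirDeriv_mem_harmonicPoly (v : EuclideanSpace ℝ (Fin d)) {k : ℕ}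
    {q : MvPolynomial (Fin d) 𝕜} (hq : q ∈ harmonicPoly 𝕜 d k) :
    dirDeriv v q ∈ harmonicPoly 𝕜 d (k - 1) := by
  obtain ⟨hh, hΔ⟩ := mem_harmonicPoly.1 hq
  refine Submodule.sum_mem _ fun i _ => ?_
  rw [MvPolynomial.C_mul']
  refine Submodule.smul_mem _ _ (mem_harmonicPoly.2 ⟨hh.pderiv, ?_⟩)
  rw [polyLaplacian_apply] at hΔ ⊢
  rw [← map_zero (MvPolynomial.pderiv i), ← hΔ, map_sum]
  refine Finset.sum_congr rfl fun j _ => ?_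
  rw [pderiv_comm j i, pderiv_comm j i]

lemma evalAt_dirDeriv_self (v : EuclideanSpace ℝ (Fin d)) {k : ℕ} {q : MvPolynomial (Fin d) 𝕜}
    (hq : q.IsHomogeneous k) : evalAt (dirDeriv v q) v = k * evalAt q v := by
  have h := congrArg (fun p => evalAt p v) hq.sum_X_mul_pderiv
  simpa [evalAt_sum, dirDeriv, ← Nat.cast_smul_eq_nsmul 𝕜] using h

lemma gaussInt_harmonic (hd : 1 ≤ d) {k : ℕ} (hk : 0 < k) {q : MvPolynomial (Fin d) 𝕜}
    (hq : q ∈ harmonicPoly 𝕜 d k) : gaussInt hd q = 0 := by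
  have h := gaussInt_euler hd hq 1
  simp only [mul_one, Derivation.map_one_eq_zero, mul_zero, map_zero,
    Finset.sum_const_zero] at h
  exact (mul_eq_zero.1 h).resolve_left (by exact_mod_cast hk.ne')

/-- A harmonic polynomial of degree `k` is orthogonal to the lower powers of linear forms. -/
lemma gaussInt_linForm_pow_mul_eq_zero (hd : 1 ≤ d) (v : Sph d) (m : ℕ) :
    ∀ {k : ℕ}, m < k → ∀ {q : MvPolynomial (Fin d) 𝕜}, q ∈ harmonicPoly 𝕜 d k →
      gaussInt hd (linForm 𝕜 (v : EuclideanSpace ℝ (Fin d)) ^ m * q) = 0 := by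
  induction m using Nat.strong_induction_on with
  | _ m ih =>
    intro k hk q hq
    rcases m with _ | _ | m
    · simpa using gaussInt_harmonic hd hk hq
    · rw [zero_add, pow_one, gaussInt_linForm_mul]
      exact gaussInt_harmonic hd (by omega) (dirDeriv_mem_harmonicPoly _ hq)
    · rw [pow_succ', mul_assoc, gaussInt_linForm_mul, dirDeriv_linForm_pow_mul, map_add, map_smul,
        ih m (by omega) (by omega) hq,
        ih (m + 1) (by omega) (by omega) (dirDeriv_mem_harmonicPoly _ hq)]
      simp

/-- The Gaussian pairing of a harmonic polynomial of degree `k` with the `k`-th power of the linear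
form `vᵀ x` is a multiple of its value at `v`. -/
lemma gaussInt_linForm_pow_mul_self (hd : 1 ≤ d) (v : Sph d) (k : ℕ) :
    ∀ {q : MvPolynomial (Fin d) 𝕜}, q ∈ harmonicPoly 𝕜 d k →
      gaussInt hd (linForm 𝕜 (v : EuclideanSpace ℝ (Fin d)) ^ k * q)
        = (k.factorial : 𝕜) * (gaussMass d : 𝕜) * evalAt q v := by
  induction k with
  | zero =>
    intro q hq
    have hq0 := (mem_harmonicPoly.1 hq).1
    obtain ⟨a, rfl⟩ : ∃ a, q = MvPolynomial.C a :=
      ⟨_, MvPolynomial.totalDegree_eq_zero_iff_eq_C.1 (Nat.le_zero.1 hq0.totalDegree_le)⟩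
    have : (MvPolynomial.C a : MvPolynomial (Fin d) 𝕜) = a • 1 := by
      rw [MvPolynomial.smul_eq_C_mul, mul_one]
    rw [pow_zero, one_mul, this, map_smul, gaussInt_one]
    simp [evalAt, mul_comm]
  | succ k ih =>
    intro q hq
    have e : gaussInt hd (linForm 𝕜 (v : EuclideanSpace ℝ (Fin d)) ^ (k + 1) * q)
        = gaussInt hd (linForm 𝕜 (v : EuclideanSpace ℝ (Fin d)) ^ k * dirDeriv v q) := by
      rw [pow_succ', mul_assoc, gaussInt_linForm_mul]
      rcases k with _ | k
      · simp
      · rw [dirDeriv_linForm_pow_mul, map_add, map_smul,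
          gaussInt_linForm_pow_mul_eq_zero hd v k (by omega) hq]
        simp
    rw [e, ih (dirDeriv_mem_harmonicPoly _ hq), evalAt_dirDeriv_self _ (mem_harmonicPoly.1 hq).1,
      Nat.factorial_succ]
    push_cast
    ring

end Algebra

/-! ### Zonal harmonics -/

section Zonal

variable {𝕜 : Type*} [RCLike 𝕜] {d : ℕ}

/-- The polynomial `|x|²`. -/
noncomputable def normSqPoly (𝕜 : Type*) [RCLike 𝕜] (d : ℕ) : MvPolynomial (Fin d) 𝕜 :=
  ∑ i, MvPolynomial.X i ^ 2

lemma isHomogeneous_normSqPoly : (normSqPoly 𝕜 d).IsHomogeneous 2 :=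
  MvPolynomial.IsHomogeneous.sum _ _ _ fun i _ => by
    simpa using (MvPolynomial.isHomogeneous_X 𝕜 i).pow 2

lemma pderiv_normSqPoly (i : Fin d) :
    MvPolynomial.pderiv i (normSqPoly 𝕜 d) = 2 * MvPolynomial.X i := by
  simp [normSqPoly, Derivation.leibniz_pow, MvPolynomial.pderiv_X, Pi.single_apply]

lemma polyLaplacian_normSqPoly_mul {n : ℕ} {f : MvPolynomial (Fin d) 𝕜} (hf : f.IsHomogeneous n) :
    polyLaplacian 𝕜 d (normSqPoly 𝕜 d * f)
      = (2 * d + 4 * n : 𝕜) • f + normSqPoly 𝕜 d * polyLaplacian 𝕜 d f := by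
  have h : ∀ i, MvPolynomial.pderiv i (MvPolynomial.pderiv i (normSqPoly 𝕜 d * f))
      = (2 : 𝕜) • f + (4 : 𝕜) • (MvPolynomial.X i * MvPolynomial.pderiv i f)
        + normSqPoly 𝕜 d * MvPolynomial.pderiv i (MvPolynomial.pderiv i f) := by
    intro i
    have h2 : MvPolynomial.pderiv i (2 : MvPolynomial (Fin d) 𝕜) = 0 :=
      Derivation.map_natCast _ 2
    simp only [Derivation.leibniz, map_add, pderiv_normSqPoly, smul_eq_mul, h2,
      MvPolynomial.pderiv_X_self, MvPolynomial.smul_eq_C_mul, map_ofNat]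
    ring
  rw [polyLaplacian_apply, Finset.sum_congr rfl fun i _ => h i, Finset.sum_add_distrib,
    Finset.sum_add_distrib, ← Finset.smul_sum, ← Finset.smul_sum,
    ← Finset.mul_sum, hf.sum_X_mul_pderiv,
    ← polyLaplacian_apply]
  simp only [Finset.sum_const, Finset.card_univ, Fintype.card_fin, ← Nat.cast_smul_eq_nsmul 𝕜,
    smul_smul, ← add_smul]

lemma polyLaplacian_linForm_pow (v : Sph d) (n : ℕ) :
    polyLaplacian 𝕜 d (linForm 𝕜 (v : EuclideanSpace ℝ (Fin d)) ^ n)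
      = ((n * (n - 1) : ℕ) : 𝕜) • linForm 𝕜 (v : EuclideanSpace ℝ (Fin d)) ^ (n - 2) := by
  set ℓ := linForm 𝕜 (v : EuclideanSpace ℝ (Fin d)) with hℓ
  have h : ∀ i, MvPolynomial.pderiv i (MvPolynomial.pderiv i (ℓ ^ n))
      = ((((v : EuclideanSpace ℝ (Fin d)) i : ℝ) : 𝕜) ^ 2 * ((n * (n - 1) : ℕ) : 𝕜)) •
        ℓ ^ (n - 2) := by
    intro i
    simp only [Derivation.leibniz_pow, Derivation.leibniz, Derivation.map_natCast, hℓ,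
      pderiv_linForm, MvPolynomial.pderiv_C,
      smul_eq_mul, MvPolynomial.smul_eq_C_mul, nsmul_eq_mul, Nat.sub_sub]
    push_cast
    simp only [map_mul, map_pow, map_natCast]
    ring
  rw [polyLaplacian_apply, Finset.sum_congr rfl fun i _ => h i, ← Finset.sum_smul,
    ← Finset.sum_mul, sum_sq_sphere, one_mul]

lemma isHomogeneous_normSqPoly_pow_mul (v : EuclideanSpace ℝ (Fin d)) (j n : ℕ) :
    (normSqPoly 𝕜 d ^ j * linForm 𝕜 v ^ n).IsHomogeneous (2 * j + n) := by
  simpa using (isHomogeneous_normSqPoly.pow j).mul ((isHomogeneous_linForm v).pow n)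

lemma polyLaplacian_normSqPoly_pow_mul (v : Sph d) (j n : ℕ) :
    polyLaplacian 𝕜 d (normSqPoly 𝕜 d ^ j * linForm 𝕜 (v : EuclideanSpace ℝ (Fin d)) ^ n)
      = (2 * j * (2 * j + d + 2 * n - 2) : 𝕜) •
          (normSqPoly 𝕜 d ^ (j - 1) * linForm 𝕜 (v : EuclideanSpace ℝ (Fin d)) ^ n)
        + ((n * (n - 1) : ℕ) : 𝕜) •
          (normSqPoly 𝕜 d ^ j * linForm 𝕜 (v : EuclideanSpace ℝ (Fin d)) ^ (n - 2)) := by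
  induction j with
  | zero => simp [polyLaplacian_linForm_pow]
  | succ j ih =>
    rw [pow_succ', mul_assoc,
      polyLaplacian_normSqPoly_mul (isHomogeneous_normSqPoly_pow_mul _ j n), ih]
    rcases j with _ | j
    · simp only [MvPolynomial.smul_eq_C_mul, zero_add]
      push_cast
      simp only [map_mul, map_add, map_sub, map_natCast, map_ofNat, map_zero, map_one]
      ring
    · simp only [MvPolynomial.smul_eq_C_mul, Nat.add_sub_cancel, pow_succ]
      push_cast
      simp only [map_mul, map_add, map_sub, map_natCast, map_ofNat, map_one]
      ring

/-- The coefficient `g_j` of `|x|^{2j} (vᵀ x)^{k-2j}` in the zonal harmonic polynomial of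
degree `k`. The recursion makes consecutive terms of the Laplacian cancel; its denominators do not
vanish when `d ≥ 1`. -/
noncomputable def zonalCoeff (d k : ℕ) : ℕ → ℝ
  | 0 => 1
  | j + 1 => -(((k - 2 * j) * (k - 2 * j - 1) : ℕ) : ℝ) /
      ((2 * (j + 1) * (2 * j + d + 2 * (k - 2 * (j + 1))) : ℕ) : ℝ) * zonalCoeff d k j

/-- The zonal harmonic polynomial `∑_j g_j |x|^{2j} (vᵀ x)^{k-2j}` of degree `k` with pole `v`. -/
noncomputable def zonalPoly (𝕜 : Type*) [RCLike 𝕜] (k : ℕ) (v : EuclideanSpace ℝ (Fin d)) :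
    MvPolynomial (Fin d) 𝕜 :=
  ∑ j ∈ Finset.range (k / 2 + 1),
    (zonalCoeff d k j : 𝕜) • (normSqPoly 𝕜 d ^ j * linForm 𝕜 v ^ (k - 2 * j))

/-- The profile `∑_j g_j t^{k-2j}` of the zonal harmonic of order `k`: a monic multiple of the
Gegenbauer polynomial. -/
noncomputable def zonalProfile (d k : ℕ) : ℝ[X] :=
  ∑ j ∈ Finset.range (k / 2 + 1), Polynomial.C (zonalCoeff d k j) * Polynomial.X ^ (k - 2 * j)

lemma zonalPoly_mem_harmonicPoly (hd : 1 ≤ d) (k : ℕ) (v : Sph d) :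
    zonalPoly 𝕜 k (v : EuclideanSpace ℝ (Fin d)) ∈ harmonicPoly 𝕜 d k := by
  refine mem_harmonicPoly.2 ⟨MvPolynomial.IsHomogeneous.sum _ _ _ fun j hj => ?_, ?_⟩
  · have hj' : 2 * j + (k - 2 * j) = k := by
      have := Finset.mem_range.1 hj
      omega
    have h := isHomogeneous_normSqPoly_pow_mul (𝕜 := 𝕜) (v : EuclideanSpace ℝ (Fin d)) j (k - 2 * j)
    rw [hj'] at h
    rw [MvPolynomial.smul_eq_C_mul]
    exact h.C_mul _
  -- the Laplacian of the last term has no second part: there the exponent `k - 2 j` is `0` or `1`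
  · have hlast : (k - 2 * (k / 2)) * (k - 2 * (k / 2) - 1) = 0 := by
      rcases Nat.mod_two_eq_zero_or_one k with h | h
      · rw [show k - 2 * (k / 2) = 0 by omega]
      · rw [show k - 2 * (k / 2) = 1 by omega]
    simp only [zonalPoly, map_sum, map_smul, polyLaplacian_normSqPoly_pow_mul, smul_add,
      Finset.sum_add_distrib]
    rw [Finset.sum_range_succ', Finset.sum_range_succ, hlast]
    simp only [Nat.cast_zero, mul_zero, zero_mul, zero_smul, smul_zero, add_zero]
    rw [← Finset.sum_add_distrib]
    refine Finset.sum_eq_zero fun j hj => ?_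
    have hne : ((2 * (j + 1) * (2 * j + d + 2 * (k - 2 * (j + 1))) : ℕ) : ℝ) ≠ 0 := by
      have : 0 < 2 * (j + 1) * (2 * j + d + 2 * (k - 2 * (j + 1))) :=
        Nat.mul_pos (by omega) (by omega)
      exact_mod_cast this.ne'
    -- the first part of the `j + 1`-st term cancels the second part of the `j`-th
    have hrec : zonalCoeff d k (j + 1) *
          ((2 * (j + 1) * (2 * j + d + 2 * (k - 2 * (j + 1))) : ℕ) : ℝ)
        + zonalCoeff d k j * (((k - 2 * j) * (k - 2 * j - 1) : ℕ) : ℝ) = 0 := by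
      rw [zonalCoeff, mul_right_comm, div_mul_cancel₀ _ hne]
      ring
    rw [show k - 2 * j - 2 = k - 2 * (j + 1) by omega, Nat.add_sub_cancel, smul_smul, smul_smul,
      ← add_smul]
    refine smul_eq_zero_of_left ?_ _
    rw [← RCLike.ofReal_zero (K := 𝕜), ← hrec]
    push_cast
    ring

lemma evalAt_normSqPoly (u : Sph d) : evalAt (normSqPoly 𝕜 d) u = 1 := by
  simp [normSqPoly, evalAt_sum, sum_sq_sphere]

lemma evalAt_zonalPoly (k : ℕ) (u v : Sph d) :
    evalAt (zonalPoly 𝕜 k (v : EuclideanSpace ℝ (Fin d))) u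
      = (((zonalProfile d k).eval (dot u v) : ℝ) : 𝕜) := by
  simp only [zonalPoly, zonalProfile, evalAt_sum, Polynomial.eval_finsetSum, evalAt_smul,
    evalAt_mul, evalAt_pow, evalAt_normSqPoly, evalAt_linForm, one_pow, one_mul,
    Polynomial.eval_mul, Polynomial.eval_C, Polynomial.eval_pow, Polynomial.eval_X]
  push_cast
  rfl

/-- The zonal harmonic `u ↦ G(uᵀ v)` of order `k`. -/
noncomputable def zonalHarmonic (𝕜 : Type*) [RCLike 𝕜] (k : ℕ) (v : Sph d) : C(Sph d, 𝕜) :=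
  restrictSphere 𝕜 d (zonalPoly 𝕜 k (v : EuclideanSpace ℝ (Fin d)))

lemma zonalHarmonic_apply (k : ℕ) (u v : Sph d) :
    zonalHarmonic 𝕜 k v u = (((zonalProfile d k).eval (dot u v) : ℝ) : 𝕜) :=
  evalAt_zonalPoly k u v

lemma zonalHarmonic_mem (hd : 1 ≤ d) (k : ℕ) (v : Sph d) :
    zonalHarmonic 𝕜 k v ∈ sphericalHarmonics 𝕜 d k :=
  Submodule.mem_map_of_mem (zonalPoly_mem_harmonicPoly hd k v)

lemma integrable_of_continuous {f : Sph d → 𝕜} (hf : Continuous f) : Integrable f (sigma d) := by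
  obtain ⟨C, hC⟩ := isCompact_univ.exists_bound_of_continuousOn hf.continuousOn
  exact Integrable.of_bound hf.aestronglyMeasurable C
    (Filter.Eventually.of_forall fun x => hC x (Set.mem_univ _))

lemma continuous_dot_left (v : Sph d) : Continuous fun u : Sph d => dot u v := by
  unfold dot; fun_prop

/-- The constant in the reproducing formula of the monic zonal harmonics. -/
noncomputable def zonalConst (d k : ℕ) : ℝ :=
  k.factorial * gaussMass d / radialMoment d (k + k)

lemma zonalConst_ne_zero (hd : 1 ≤ d) (k : ℕ) : zonalConst d k ≠ 0 :=
  div_ne_zero (mul_ne_zero (by exact_mod_cast k.factorial_ne_zero) (gaussMass_pos hd).ne')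
    (radialMoment_ne_zero hd _)

lemma radialMoment_mul_integral_dot_pow_mul (hd : 1 ≤ d) (m k : ℕ) (v : Sph d)
    {p : MvPolynomial (Fin d) 𝕜} (hp : p ∈ harmonicPoly 𝕜 d k) :
    (radialMoment d (m + k) : 𝕜) * ∫ u, (dot u v : 𝕜) ^ m * restrictSphere 𝕜 d p u ∂(sigma d)
      = gaussInt hd (linForm 𝕜 (v : EuclideanSpace ℝ (Fin d)) ^ m * p) := by
  have h := gaussInt_eq_radialMoment_mul hd (((isHomogeneous_linForm (𝕜 := 𝕜)
    (v : EuclideanSpace ℝ (Fin d))).pow m).mul (mem_harmonicPoly.1 hp).1)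
  rw [one_mul] at h
  rw [h]
  simp [restrictSphere_apply, evalAt_linForm]

lemma integral_dot_pow_mul_eq_zero (hd : 1 ≤ d) {m k : ℕ} (hmk : m < k) (v : Sph d)
    {φ : C(Sph d, 𝕜)} (hφ : φ ∈ sphericalHarmonics 𝕜 d k) :
    ∫ u, (dot u v : 𝕜) ^ m * φ u ∂(sigma d) = 0 := by
  obtain ⟨p, hp, rfl⟩ := hφ
  have h := radialMoment_mul_integral_dot_pow_mul hd m k v hp
  rw [gaussInt_linForm_pow_mul_eq_zero hd v m hmk hp] at h
  exact (mul_eq_zero.1 h).resolve_left (by exact_mod_cast radialMoment_ne_zero hd (m + k))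

lemma integral_dot_pow_mul_self (hd : 1 ≤ d) {k : ℕ} (v : Sph d)
    {φ : C(Sph d, 𝕜)} (hφ : φ ∈ sphericalHarmonics 𝕜 d k) :
    ∫ u, (dot u v : 𝕜) ^ k * φ u ∂(sigma d) = (zonalConst d k : 𝕜) * φ v := by
  obtain ⟨p, hp, rfl⟩ := hφ
  have h := radialMoment_mul_integral_dot_pow_mul hd k k v hp
  rw [gaussInt_linForm_pow_mul_self hd v k hp] at h
  have hne : (radialMoment d (k + k) : 𝕜) ≠ 0 := by
    exact_mod_cast radialMoment_ne_zero hd (k + k)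
  rw [restrictSphere_apply, zonalConst]
  push_cast
  field_simp
  rw [mul_comm]
  exact h

/-- The zonal harmonics reproduce the spherical harmonics of the same order: only the leading
power of `uᵀ v` contributes. -/
lemma integral_zonalProfile_mul (hd : 1 ≤ d) {k : ℕ} (v : Sph d)
    {φ : C(Sph d, 𝕜)} (hφ : φ ∈ sphericalHarmonics 𝕜 d k) :
    ∫ u, (((zonalProfile d k).eval (dot u v) : ℝ) : 𝕜) * φ u ∂(sigma d)
      = (zonalConst d k : 𝕜) * φ v := by
  have hint : ∀ j, Integrable (fun u => (zonalCoeff d k j : 𝕜) *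
      ((dot u v : 𝕜) ^ (k - 2 * j) * φ u)) (sigma d) := fun j =>
    integrable_of_continuous (continuous_const.mul
      (((RCLike.continuous_ofReal.comp (continuous_dot_left v)).pow _).mul φ.continuous))
  have e : ∀ u, (((zonalProfile d k).eval (dot u v) : ℝ) : 𝕜) * φ u
      = ∑ j ∈ Finset.range (k / 2 + 1), (zonalCoeff d k j : 𝕜) *
        ((dot u v : 𝕜) ^ (k - 2 * j) * φ u) := by
    intro u
    simp [zonalProfile, Polynomial.eval_finsetSum, Finset.sum_mul, mul_assoc]
  simp only [e]
  rw [integral_finsetSum _ fun j _ => hint j, Finset.sum_range_succ',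
    Finset.sum_eq_zero fun j hj => ?_]
  · rw [integral_const_mul]
    simp [integral_dot_pow_mul_self hd v hφ, zonalCoeff]
  -- the remaining exponents `k - 2 (j + 1)` are smaller than `k`
  · have := Finset.mem_range.1 hj
    rw [integral_const_mul, integral_dot_pow_mul_eq_zero hd (by omega) v hφ, mul_zero]

/-- Every power of `t` is a combination of the zonal profiles of at most the same order. -/
lemma exists_X_pow_eq_sum_zonalProfile (d m : ℕ) : ∃ c : ℕ → ℝ,
    (Polynomial.X ^ m : ℝ[X]) = ∑ j ∈ Finset.range (m + 1), c j • zonalProfile d j := by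
  have h : ∀ m : ℕ, (Polynomial.X ^ m : ℝ[X]) ∈
      Submodule.span ℝ (zonalProfile d '' (Finset.range (m + 1) : Set ℕ)) := by
    intro m
    induction m using Nat.strong_induction_on with
    | _ m ih =>
      have e : (Polynomial.X ^ m : ℝ[X]) = zonalProfile d m
          - ∑ j ∈ Finset.range (m / 2), zonalCoeff d m (j + 1) •
            (Polynomial.X ^ (m - 2 * (j + 1)) : ℝ[X]) := by
        rw [zonalProfile, Finset.sum_range_succ']
        simp [zonalCoeff, Polynomial.smul_eq_C_mul]
      rw [e]
      refine Submodule.sub_mem _ (Submodule.subset_span ⟨m, by simp, rfl⟩)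
        (Submodule.sum_mem _ fun j hj => Submodule.smul_mem _ _ ?_)
      have := Finset.mem_range.1 hj
      refine Submodule.span_mono (Set.image_mono ?_) (ih (m - 2 * (j + 1)) (by omega))
      exact_mod_cast Finset.range_mono (by omega)
  obtain ⟨c, hc, hsum⟩ := (Finsupp.mem_span_image_iff_linearCombination ℝ).1 (h m)
  refine ⟨c, hsum.symm.trans ?_⟩
  rw [Finsupp.linearCombination_apply]
  exact Finsupp.sum_of_support_subset _ (by exact_mod_cast (Finsupp.mem_supported ℝ c).1 hc) _
    (by simp)

lemma zonalProfile_monic (d k : ℕ) : (zonalProfile d k).Monic := by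
  rw [zonalProfile, Finset.sum_range_succ']
  simp only [zonalCoeff, map_one, one_mul, mul_zero, Nat.sub_zero]
  rw [add_comm]
  refine Polynomial.monic_X_pow_add (Polynomial.mem_degreeLT.1 (Submodule.sum_mem _ fun j hj => ?_))
  have := Finset.mem_range.1 hj
  refine Polynomial.mem_degreeLT.2 (lt_of_le_of_lt (Polynomial.degree_C_mul_X_pow_le _ _) ?_)
  exact_mod_cast (by omega : k - 2 * (j + 1) < k)

end Zonal

/-! ### Reproducing kernels and Legendre polynomials -/

section Legendre

variable {𝕜 : Type*} [RCLike 𝕜] {d : ℕ}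

instance finiteDimensional_sphericalHarmonics (k : ℕ) :
    FiniteDimensional 𝕜 (sphericalHarmonics 𝕜 d k) := by
  have hle : harmonicPoly 𝕜 d k ≤ MvPolynomial.restrictTotalDegree (Fin d) 𝕜 k := fun p hp =>
    (MvPolynomial.mem_restrictTotalDegree _ _ _).2 (mem_harmonicPoly.1 hp).1.totalDegree_le
  have : FiniteDimensional 𝕜 (harmonicPoly 𝕜 d k) := Submodule.finiteDimensional_of_le hle
  exact Module.Finite.map _ _

/-- The orthonormal basis is constructed in `L²`, where the spherical harmonics embed because `σ`
has full support, and pulled back. -/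
lemma exists_isHarmonicONB (d k : ℕ) : ∃ φ : Fin (nu d k) → C(Sph d, ℝ), IsHarmonicONB d k φ := by
  let T : C(Sph d, ℝ) →ₗ[ℝ] Lp ℝ 2 (sigma d) := (ContinuousMap.toLp 2 (sigma d) ℝ).toLinearMap
  have hinj : Function.Injective T := ContinuousMap.toLp_injective (p := 2) (𝕜 := ℝ) (sigma d)
  have hT : ∀ f g : C(Sph d, ℝ), inner ℝ (T f) (T g) = ∫ ω, f ω * g ω ∂(sigma d) := fun f g =>
    (ContinuousMap.inner_toLp (sigma d) f g).trans (by simp only [conj_trivial, mul_comm])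
  obtain ⟨e, he⟩ : ∃ e : sphericalHarmonics ℝ d k ≃ₗ[ℝ] (sphericalHarmonics ℝ d k).map T,
      ∀ f, (e f : Lp ℝ 2 (sigma d)) = T f :=
    ⟨Submodule.equivMapOfInjective T hinj _, Submodule.coe_equivMapOfInjective_apply T hinj _⟩
  clear_value T
  have : FiniteDimensional ℝ ((sphericalHarmonics ℝ d k).map T) := Module.Finite.map _ _
  have hfin : Module.finrank ℝ ((sphericalHarmonics ℝ d k).map T) = nu d k := e.finrank_eq.symm
  obtain ⟨b⟩ : Nonempty (OrthonormalBasis (Fin (nu d k)) ℝ ((sphericalHarmonics ℝ d k).map T)) :=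
    ⟨(stdOrthonormalBasis ℝ ((sphericalHarmonics ℝ d k).map T)).reindex (finCongr hfin)⟩
  refine ⟨fun i => (e.symm (b i) : C(Sph d, ℝ)), fun i j => ?_, ?_⟩
  · rw [← orthonormal_iff_ite.1 b.orthonormal i j, Submodule.coe_inner, ← hT, ← he, ← he,
      LinearEquiv.apply_symm_apply, LinearEquiv.apply_symm_apply]
  · have h : Set.range (fun i => (e.symm (b i) : C(Sph d, ℝ)))
        = ((sphericalHarmonics ℝ d k).subtype ∘ₗ e.symm.toLinearMap) '' Set.range b := by
      rw [← Set.range_comp]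
      rfl
    rw [h, ← Submodule.map_span, ← b.coe_toBasis, b.toBasis.span_eq, Submodule.map_top,
      LinearMap.range_comp, LinearEquiv.range, Submodule.map_top, Submodule.range_subtype]

/-- The first standard basis vector, as a point of the sphere. -/
noncomputable def pole (hd : 1 ≤ d) : Sph d :=
  ⟨EuclideanSpace.single ⟨0, hd⟩ 1, by simp⟩

lemma dot_pole (hd : 1 ≤ d) (u : Sph d) :
    dot u (pole hd) = (u : EuclideanSpace ℝ (Fin d)) ⟨0, hd⟩ := by
  simp [dot, pole, EuclideanSpace.inner_single_right]

/-- This is where `d ≥ 2` matters: the sphere `S^0` has only the two values `±1` of `uᵀ v`. -/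
lemma exists_dot_pole_eq (hd : 2 ≤ d) {t : ℝ} (ht : t ∈ Set.Icc (-1 : ℝ) 1) :
    ∃ u : Sph d, dot u (pole (by omega)) = t := by
  have hne : (⟨1, hd⟩ : Fin d) ≠ ⟨0, by omega⟩ := by simp
  have hs : 0 ≤ 1 - t ^ 2 := by nlinarith [ht.1, ht.2]
  refine ⟨⟨EuclideanSpace.single ⟨0, by omega⟩ t
    + EuclideanSpace.single ⟨1, hd⟩ (√(1 - t ^ 2)), ?_⟩, ?_⟩
  · rw [mem_sphere_zero_iff_norm, ← sq_eq_sq₀ (norm_nonneg _) zero_le_one,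
      norm_add_sq_real]
    simp [EuclideanSpace.inner_single_right, hne, Real.sq_sqrt hs, sq_abs]
  · rw [dot_pole]
    simp [hne.symm]

lemma zonalHarmonic_pole_ne_zero (hd : 2 ≤ d) (k : ℕ) :
    zonalHarmonic 𝕜 k (pole (d := d) (by omega)) ≠ 0 := by
  intro h
  refine (zonalProfile_monic d k).ne_zero
    (Polynomial.eq_zero_of_infinite_isRoot _ ((Set.Icc_infinite (by norm_num : (-1 : ℝ) < 1)).mono
      fun t ht => ?_))
  obtain ⟨u, hu⟩ := exists_dot_pole_eq hd ht
  have h2 := DFunLike.congr_fun h u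
  rw [zonalHarmonic_apply, hu] at h2
  exact RCLike.ofReal_eq_zero.1 h2

lemma nu_ne_zero (hd : 2 ≤ d) (k : ℕ) : nu d k ≠ 0 := by
  intro h
  have h1 := zonalHarmonic_mem (𝕜 := ℝ) (by omega) k (pole (d := d) (by omega))
  rw [Submodule.finrank_eq_zero.1 h] at h1
  exact zonalHarmonic_pole_ne_zero hd k h1

lemma area_pos (hd : 1 ≤ d) : 0 < area d := by
  have : Nonempty (Fin d) := ⟨⟨0, hd⟩⟩
  have h : sigma d ≠ 0 := Measure.toSphere_ne_zero _
  exact ENNReal.toReal_pos (Measure.measure_univ_ne_zero.2 h) (measure_ne_top _ _)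

/-- The reproducing kernel of the spherical harmonics of order `k`, defined as the zonal harmonic
divided by the constant in its reproducing formula. -/
noncomputable def reproKernel (k : ℕ) (u v : Sph d) : ℝ :=
  (zonalConst d k)⁻¹ * (zonalProfile d k).eval (dot u v)

/-- The addition theorem: expanding the zonal harmonic with pole `v` in an orthonormal basis, its
coefficients are given by the reproducing formula. -/
lemma sum_harmonicONB_mul (hd : 1 ≤ d) {k : ℕ} {φ : Fin (nu d k) → C(Sph d, ℝ)}
    (hφ : IsHarmonicONB d k φ) (u v : Sph d) : ∑ i, φ i u * φ i v = reproKernel k u v := by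
  have hmem := zonalHarmonic_mem (𝕜 := ℝ) hd k v
  rw [← hφ.2] at hmem
  obtain ⟨a, ha⟩ := (Submodule.mem_span_range_iff_exists_fun ℝ).1 hmem
  have hval : ∀ w, (zonalProfile d k).eval (dot w v) = ∑ i, a i * φ i w := by
    intro w
    have := zonalHarmonic_apply (𝕜 := ℝ) k w v
    rw [← ha] at this
    simpa using this.symm
  have hcoef : ∀ j, a j = zonalConst d k * φ j v := by
    intro j
    have hj : φ j ∈ sphericalHarmonics ℝ d k := hφ.2 ▸ Submodule.subset_span ⟨j, rfl⟩
    have h := integral_zonalProfile_mul hd v hj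
    simp only [RCLike.ofReal_real_eq_id, id] at h
    rw [← h]
    simp only [hval, Finset.sum_mul, mul_assoc]
    have hint : ∀ i, Integrable (fun w => a i * (φ i w * φ j w)) (sigma d) := fun i =>
      integrable_of_continuous (𝕜 := ℝ)
        (continuous_const.mul ((φ i).continuous.mul (φ j).continuous))
    rw [integral_finsetSum _ fun i _ => hint i]
    simp [integral_const_mul, hφ.1]
  rw [reproKernel, hval, Finset.mul_sum]
  refine Finset.sum_congr rfl fun i _ => ?_
  rw [hcoef]
  field_simp [zonalConst_ne_zero hd k]

/-- The normalised zonal profile is a Legendre polynomial, so one exists. -/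
lemma isLegendre_legendreP (hd : 2 ≤ d) (k : ℕ) : IsLegendre d k (legendreP d k) := by
  refine Classical.epsilon_spec (p := IsLegendre d k)
    ⟨Polynomial.C (area d / nu d k * (zonalConst d k)⁻¹) * zonalProfile d k, fun φ hφ u v => ?_⟩
  have h1 := (area_pos (d := d) (by omega)).ne'
  have h2 : (nu d k : ℝ) ≠ 0 := by exact_mod_cast nu_ne_zero hd k
  rw [sum_harmonicONB_mul (by omega) hφ, reproKernel, Polynomial.eval_mul, Polynomial.eval_C]
  field_simp

lemma legendreP_eval_dot (hd : 2 ≤ d) (k : ℕ) (u v : Sph d) :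
    (legendreP d k).eval (dot u v) = area d / nu d k * reproKernel k u v := by
  obtain ⟨φ, hφ⟩ := exists_isHarmonicONB d k
  have h := isLegendre_legendreP hd k φ hφ u v
  rw [sum_harmonicONB_mul (by omega) hφ] at h
  have h1 := (area_pos (d := d) (by omega)).ne'
  have h2 : (nu d k : ℝ) ≠ 0 := by exact_mod_cast nu_ne_zero hd k
  rw [h]
  field_simp

/-- As `t^m` is a combination of the monic profiles, of which the Legendre polynomials are nonzero
multiples on `[-1, 1]`, a Legendre expansion exists. -/
lemma isLegendreExpansion_legendreCoeff (hd : 2 ≤ d) (m : ℕ) :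
    IsLegendreExpansion d m (legendreCoeff d m) := by
  obtain ⟨c, hc⟩ := exists_X_pow_eq_sum_zonalProfile d m
  refine Classical.epsilon_spec (p := IsLegendreExpansion d m)
    ⟨fun j => if j ≤ m then c j * (nu d j / area d * zonalConst d j) else 0, fun t ht => ?_,
      fun j hj => if_neg (by omega)⟩
  obtain ⟨u, rfl⟩ := exists_dot_pole_eq hd ht
  have h := congrArg (Polynomial.eval (dot u (pole (by omega)))) hc
  simp only [Polynomial.eval_pow, Polynomial.eval_X, Polynomial.eval_finsetSum,
    Polynomial.eval_smul, smul_eq_mul] at h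
  rw [h]
  refine Finset.sum_congr rfl fun j hj => ?_
  have h1 := (area_pos (d := d) (by omega)).ne'
  have h2 : (nu d j : ℝ) ≠ 0 := by exact_mod_cast nu_ne_zero hd j
  have h3 := zonalConst_ne_zero (d := d) (by omega) j
  simp only
  rw [if_pos (by have := Finset.mem_range.1 hj; omega), legendreP_eval_dot hd, reproKernel]
  field_simp

lemma dot_mem_Icc (u v : Sph d) : dot u v ∈ Set.Icc (-1 : ℝ) 1 := by
  have h := abs_real_inner_le_norm (u : EuclideanSpace ℝ (Fin d)) (v : EuclideanSpace ℝ (Fin d))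
  simp only [norm_eq_of_mem_sphere, mul_one] at h
  exact abs_le.1 h

lemma dot_pow_eq_sum (hd : 2 ≤ d) (m : ℕ) (u v : Sph d) :
    dot u v ^ m = ∑ j ∈ Finset.range (m + 1),
      area d * (legendreCoeff d m j / nu d j) * reproKernel j u v := by
  rw [(isLegendreExpansion_legendreCoeff hd m).1 _ (dot_mem_Icc u v)]
  refine Finset.sum_congr rfl fun j _ => ?_
  rw [legendreP_eval_dot hd]
  ring

end Legendre

/-! ### Expansion of the covariance kernel -/

section KernelExpansion

variable {𝕜 : Type*} [RCLike 𝕜] {d : ℕ}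

lemma dot_comm (u v : Sph d) : dot u v = dot v u := real_inner_comm _ _

lemma continuous_reproKernel (k : ℕ) (v : Sph d) : Continuous fun u => reproKernel k u v :=
  continuous_const.mul ((zonalProfile d k).continuous.comp (continuous_dot_left v))

lemma ofReal_reproKernel_mem (hd : 1 ≤ d) (k : ℕ) (v : Sph d) :
    ∃ f ∈ sphericalHarmonics 𝕜 d k, ∀ u, f u = (reproKernel k u v : 𝕜) :=
  ⟨(((zonalConst d k)⁻¹ : ℝ) : 𝕜) • zonalHarmonic 𝕜 k v,
    Submodule.smul_mem _ _ (zonalHarmonic_mem hd k v), fun u => by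
      simp [reproKernel, zonalHarmonic_apply]⟩

/-- Integration against the reproducing kernel of order `j` is the identity on spherical harmonics
of order `j` and vanishes on those of any other order. -/
lemma integral_reproKernel_mul (hd : 1 ≤ d) (j k : ℕ) (v : Sph d) {φ : C(Sph d, 𝕜)}
    (hφ : φ ∈ sphericalHarmonics 𝕜 d k) :
    ∫ u, (reproKernel j u v : 𝕜) * φ u ∂(sigma d) = if j = k then φ v else 0 := by
  split_ifs with h
  · subst h
    have h0 : (zonalConst d j : 𝕜) ≠ 0 := by exact_mod_cast zonalConst_ne_zero hd j
    simp only [reproKernel, RCLike.ofReal_mul, mul_assoc]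
    rw [integral_const_mul, integral_zonalProfile_mul hd v hφ, RCLike.ofReal_inv,
      inv_mul_cancel_left₀ h0]
  · obtain ⟨f, hf, hfv⟩ := ofReal_reproKernel_mem (𝕜 := 𝕜) hd j v
    simp only [← hfv]
    exact integral_mul_sphericalHarmonics_eq_zero hd h hf hφ

lemma integral_reproKernel_mul_reproKernel (hd : 1 ≤ d) (j l : ℕ) (b c : Sph d) :
    ∫ u, reproKernel j u b * reproKernel l u c ∂(sigma d)
      = if j = l then reproKernel l b c else 0 := by
  obtain ⟨f, hf, hfc⟩ := ofReal_reproKernel_mem (𝕜 := ℝ) hd l c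
  have h := integral_reproKernel_mul hd j l b hf
  simpa only [hfc, RCLike.ofReal_real_eq_id, id] using h

lemma one_mem_sphericalHarmonics (d : ℕ) : (1 : C(Sph d, 𝕜)) ∈ sphericalHarmonics 𝕜 d 0 := by
  refine ⟨1, mem_harmonicPoly.2 ⟨MvPolynomial.isHomogeneous_one _ _, ?_⟩, ?_⟩
  · simp [polyLaplacian_apply]
  · ext x
    simp [restrictSphere_apply, evalAt]

lemma integral_reproKernel (hd : 1 ≤ d) (j : ℕ) (v : Sph d) :
    ∫ u, reproKernel j u v ∂(sigma d) = if j = 0 then 1 else 0 := by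
  have h := integral_reproKernel_mul hd j 0 v (one_mem_sphericalHarmonics (𝕜 := ℝ) d)
  simpa using h

lemma reproKernel_zero (hd : 1 ≤ d) (u v : Sph d) : reproKernel 0 u v = (area d)⁻¹ := by
  have hc : ∀ w, reproKernel 0 w v = (zonalConst d 0)⁻¹ := fun w => by
    simp [reproKernel, zonalProfile, zonalCoeff]
  have h := integral_reproKernel hd 0 v
  simp only [hc, integral_const, smul_eq_mul, if_true] at h
  rw [hc]
  exact eq_inv_of_mul_eq_one_right h

/-- The product of the two expansions is integrated term by term; the mixed terms vanish and
`∫ Z_j(u, b) Z_j(u, c) dσ(u) = Z_j(b, c)`. -/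
lemma eta_eq_sum (hd : 2 ≤ d) (β : ℕ) (b c : Sph d) :
    eta d β b c = ∑ j ∈ Finset.range (β + 1),
      area d * (legendreCoeff d β j / nu d j) ^ 2 * reproKernel j b c := by
  have hd1 : 1 ≤ d := by omega
  have ha := (area_pos hd1).ne'
  have hint : ∀ i j, Integrable (fun ω => area d ^ 2 * (legendreCoeff d β i / nu d i) *
      (legendreCoeff d β j / nu d j) * (reproKernel i ω b * reproKernel j ω c)) (sigma d) :=
    fun i j => integrable_of_continuous (𝕜 := ℝ) (continuous_const.mul
      ((continuous_reproKernel i b).mul (continuous_reproKernel j c)))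
  have e : ∀ ω, dot b ω ^ β * dot c ω ^ β
      = ∑ i ∈ Finset.range (β + 1), ∑ j ∈ Finset.range (β + 1),
        area d ^ 2 * (legendreCoeff d β i / nu d i) * (legendreCoeff d β j / nu d j) *
          (reproKernel i ω b * reproKernel j ω c) := by
    intro ω
    rw [dot_comm b, dot_comm c, dot_pow_eq_sum hd, dot_pow_eq_sum hd, Finset.sum_mul_sum]
    exact Finset.sum_congr rfl fun i _ => Finset.sum_congr rfl fun j _ => by ring
  rw [eta, uniformMean]
  simp only [e]
  rw [integral_finsetSum _ fun i _ => integrable_finsetSum _ fun j _ => hint i j, Finset.mul_sum]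
  refine Finset.sum_congr rfl fun i hi => ?_
  rw [integral_finsetSum _ fun j _ => hint i j]
  simp only [integral_const_mul, integral_reproKernel_mul_reproKernel hd1, mul_ite, mul_zero]
  rw [Finset.sum_ite_eq, if_pos hi]
  field_simp

/-- The mean `ψ` is the coefficient of order `0`: the other reproducing kernels integrate to `0`. -/
lemma psi_eq (hd : 2 ≤ d) (β : ℕ) : psi d β = legendreCoeff d β 0 / nu d 0 := by
  have hd1 : 1 ≤ d := by omega
  have ha := (area_pos hd1).ne'
  rw [psi, dif_pos (by omega), uniformMean]
  simp only [← dot_pole hd1, dot_pow_eq_sum hd]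
  have hint : ∀ j, Integrable (fun ω => area d * (legendreCoeff d β j / nu d j) *
      reproKernel j ω (pole hd1)) (sigma d) := fun j =>
    integrable_of_continuous (𝕜 := ℝ) (continuous_const.mul (continuous_reproKernel j _))
  rw [integral_finsetSum _ fun j _ => hint j]
  simp only [integral_const_mul, integral_reproKernel hd1, mul_ite, mul_one, mul_zero]
  rw [Finset.sum_ite_eq', if_pos (by simp)]
  field_simp

/-- The covariance kernel is a combination of reproducing kernels; subtracting `ψ²` removes exactly
the term of order `0`. -/
lemma rho_eq_sum (hd : 2 ≤ d) (β : ℕ) (b c : Sph d) :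
    rho d β b c = ∑ j ∈ Finset.range (β + 1), area d * eigval d β j * reproKernel j b c := by
  have hd1 : 1 ≤ d := by omega
  have ha := (area_pos hd1).ne'
  rw [rho, eta_eq_sum hd, psi_eq hd, Finset.sum_range_succ', Finset.sum_range_succ',
    reproKernel_zero hd1, add_sub_assoc]
  congr 1
  · refine Finset.sum_congr rfl fun j hj => ?_
    rw [eigval, if_pos ⟨by omega, by have := Finset.mem_range.1 hj; omega⟩]
  · simp only [eigval, lt_irrefl, false_and, if_false]
    field_simp
    simp

lemma kernelInt_eq_sum (hd : 2 ≤ d) (β : ℕ) {f : Sph d → 𝕜} (hf : Integrable f (sigma d))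
    (x : Sph d) : kernelInt d β f x = ∑ j ∈ Finset.range (β + 1),
      (eigval d β j : 𝕜) * ∫ ω, (reproKernel j ω x : 𝕜) * f ω ∂(sigma d) := by
  have ha : (area d : 𝕜) ≠ 0 := by exact_mod_cast (area_pos (d := d) (by omega)).ne'
  have hint : ∀ j, Integrable (fun ω => ((area d * eigval d β j : ℝ) : 𝕜) *
      ((reproKernel j ω x : 𝕜) * f ω)) (sigma d) := by
    intro j
    obtain ⟨C, hC⟩ := isCompact_univ.exists_bound_of_continuousOn
      (continuous_reproKernel j x).continuousOn
    refine (hf.bdd_mul (c := C) (RCLike.continuous_ofReal.comp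
      (continuous_reproKernel j x)).aestronglyMeasurable
      (Filter.Eventually.of_forall fun ω => ?_)).const_mul _
    simpa using hC ω (Set.mem_univ _)
  have e : ∀ ω, (rho d β ω x : 𝕜) * f ω = ∑ j ∈ Finset.range (β + 1),
      ((area d * eigval d β j : ℝ) : 𝕜) * ((reproKernel j ω x : 𝕜) * f ω) := by
    intro ω
    rw [rho_eq_sum hd]
    push_cast
    rw [Finset.sum_mul]
    exact Finset.sum_congr rfl fun j _ => by ring
  rw [kernelInt]
  simp only [e]
  rw [integral_finsetSum _ fun j _ => hint j, Finset.mul_sum]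
  refine Finset.sum_congr rfl fun j _ => ?_
  rw [integral_const_mul]
  push_cast
  field_simp

lemma kernelInt_sphericalHarmonic (hd : 2 ≤ d) (β k : ℕ) {φ : C(Sph d, 𝕜)}
    (hφ : φ ∈ sphericalHarmonics 𝕜 d k) (x : Sph d) :
    kernelInt d β φ x = (eigval d β k : 𝕜) * φ x := by
  rw [kernelInt_eq_sum hd β (integrable_of_continuous φ.continuous)]
  simp only [integral_reproKernel_mul (by omega : 1 ≤ d) _ k x hφ, mul_ite, mul_zero]
  rw [Finset.sum_ite_eq']
  split_ifs with h
  · rfl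
  · rw [eigval, if_neg (by rw [Finset.mem_range] at h; omega)]
    simp

/-- The eigenvalue equation in `L²`. -/
lemma opK_toLp (hd : 2 ≤ d) (β k : ℕ) {φ : C(Sph d, 𝕜)} (hφ : φ ∈ sphericalHarmonics 𝕜 d k) :
    opK 𝕜 d β (ContinuousMap.toLp 2 (sigma d) 𝕜 φ)
      = (eigval d β k : 𝕜) • ContinuousMap.toLp 2 (sigma d) 𝕜 φ := by
  rw [← map_smul]
  refine Lp.ext ?_
  filter_upwards [opK_coe 𝕜 d β (ContinuousMap.toLp 2 (sigma d) 𝕜 φ),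
    ContinuousMap.coeFn_toLp (p := 2) (𝕜 := 𝕜) (sigma d) ((eigval d β k : 𝕜) • φ)] with x h1 h2
  rw [h1, h2, ContinuousMap.smul_apply, smul_eq_mul, ← kernelInt_sphericalHarmonic hd β k hφ x,
    kernelInt, kernelInt]
  congr 1
  refine integral_congr_ae ?_
  filter_upwards [ContinuousMap.coeFn_toLp (p := 2) (𝕜 := 𝕜) (sigma d) φ] with ω hω
  rw [hω]

end KernelExpansion

/-! ### The spectral decomposition of `K_β` -/

section Spectral

variable {𝕜 : Type*} [RCLike 𝕜] {d : ℕ}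

/-- A real-valued continuous function on the sphere, regarded as a `𝕜`-valued one. -/
def coeMap (𝕜 : Type*) [RCLike 𝕜] (f : C(Sph d, ℝ)) : C(Sph d, 𝕜) :=
  ⟨fun x => (f x : 𝕜), RCLike.continuous_ofReal.comp f.continuous⟩

lemma coeMap_mem_sphericalHarmonics {k : ℕ} {f : C(Sph d, ℝ)}
    (hf : f ∈ sphericalHarmonics ℝ d k) : coeMap 𝕜 f ∈ sphericalHarmonics 𝕜 d k := by
  obtain ⟨p, hp, rfl⟩ := hf
  obtain ⟨hh, hΔ⟩ := mem_harmonicPoly.1 hp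
  refine ⟨MvPolynomial.map (algebraMap ℝ 𝕜) p, mem_harmonicPoly.2 ⟨hh.map _, ?_⟩, ?_⟩
  · simp only [polyLaplacian_apply, MvPolynomial.pderiv_map, ← map_sum] at hΔ ⊢
    rw [hΔ, map_zero]
  · ext x
    simp only [restrictSphere_apply, evalAt, coeMap, ContinuousMap.coe_mk,
      MvPolynomial.eval_map, ← RCLike.algebraMap_eq_ofReal]
    exact MvPolynomial.eval₂_comp_left (algebraMap ℝ 𝕜) (RingHom.id ℝ) _ p |>.symm

/-- A chosen real orthonormal basis of the spherical harmonics of order `k`. -/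
noncomputable def harmonicBasis (d k : ℕ) : Fin (nu d k) → C(Sph d, ℝ) :=
  (exists_isHarmonicONB d k).choose

lemma isHarmonicONB_harmonicBasis (d k : ℕ) : IsHarmonicONB d k (harmonicBasis d k) :=
  (exists_isHarmonicONB d k).choose_spec

lemma harmonicBasis_mem (k : ℕ) (i : Fin (nu d k)) :
    harmonicBasis d k i ∈ sphericalHarmonics ℝ d k :=
  (isHarmonicONB_harmonicBasis d k).2 ▸ Submodule.subset_span ⟨i, rfl⟩

/-- The chosen orthonormal basis of the spherical harmonics of order `k` in `L²`. -/
noncomputable def harmonicLp (𝕜 : Type*) [RCLike 𝕜] (d k : ℕ) (i : Fin (nu d k)) :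
    Lp 𝕜 2 (sigma d) :=
  ContinuousMap.toLp 2 (sigma d) 𝕜 (coeMap 𝕜 (harmonicBasis d k i))

lemma opK_harmonicLp (hd : 2 ≤ d) (β k : ℕ) (i : Fin (nu d k)) :
    opK 𝕜 d β (harmonicLp 𝕜 d k i) = (eigval d β k : 𝕜) • harmonicLp 𝕜 d k i :=
  opK_toLp hd β k (coeMap_mem_sphericalHarmonics (harmonicBasis_mem k i))

lemma inner_harmonicLp (k : ℕ) (i : Fin (nu d k)) (f : Lp 𝕜 2 (sigma d)) :
    inner 𝕜 (harmonicLp 𝕜 d k i) f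
      = ∫ ω, (harmonicBasis d k i ω : 𝕜) * f ω ∂(sigma d) := by
  rw [L2.inner_def]
  refine integral_congr_ae ?_
  filter_upwards [ContinuousMap.coeFn_toLp (p := 2) (𝕜 := 𝕜) (sigma d)
    (coeMap 𝕜 (harmonicBasis d k i))] with ω hω
  rw [harmonicLp, hω]
  simp [coeMap, mul_comm]

lemma integral_reproKernel_mul_eq_sum (hd : 1 ≤ d) (k : ℕ) (f : Lp 𝕜 2 (sigma d)) (x : Sph d) :
    ∫ ω, (reproKernel k ω x : 𝕜) * f ω ∂(sigma d)
      = ∑ i, inner 𝕜 (harmonicLp 𝕜 d k i) f * (harmonicBasis d k i x : 𝕜) := by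
  have hint : ∀ i, Integrable (fun ω => (harmonicBasis d k i ω : 𝕜) * f ω *
      (harmonicBasis d k i x : 𝕜)) (sigma d) := by
    intro i
    obtain ⟨C, hC⟩ := isCompact_univ.exists_bound_of_continuousOn
      (harmonicBasis d k i).continuous.continuousOn
    refine ((integrable_coe f).bdd_mul (c := C) (RCLike.continuous_ofReal.comp
      (harmonicBasis d k i).continuous).aestronglyMeasurable
      (Filter.Eventually.of_forall fun ω => ?_)).mul_const _
    simpa using hC ω (Set.mem_univ _)
  simp only [inner_harmonicLp, ← integral_mul_const]
  rw [← integral_finsetSum _ fun i _ => hint i]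
  refine integral_congr_ae (Filter.Eventually.of_forall fun ω => ?_)
  simp only [← sum_harmonicONB_mul hd (isHarmonicONB_harmonicBasis d k)]
  push_cast
  rw [Finset.sum_mul]
  exact Finset.sum_congr rfl fun i _ => by ring

/-- The spectral expansion of `K_β`. -/
lemma opK_eq_sum (hd : 2 ≤ d) (β : ℕ) (f : Lp 𝕜 2 (sigma d)) :
    opK 𝕜 d β f = ∑ j ∈ Finset.range (β + 1), (eigval d β j : 𝕜) •
      ∑ i, inner 𝕜 (harmonicLp 𝕜 d j i) f • harmonicLp 𝕜 d j i := by
  have e : ∑ j ∈ Finset.range (β + 1), (eigval d β j : 𝕜) •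
      ∑ i, inner 𝕜 (harmonicLp 𝕜 d j i) f • harmonicLp 𝕜 d j i
      = ContinuousMap.toLp 2 (sigma d) 𝕜 (∑ j ∈ Finset.range (β + 1), (eigval d β j : 𝕜) •
        ∑ i, inner 𝕜 (harmonicLp 𝕜 d j i) f • coeMap 𝕜 (harmonicBasis d j i)) := by
    simp only [map_sum, map_smul, harmonicLp]
  rw [e]
  refine Lp.ext ?_
  filter_upwards [opK_coe 𝕜 d β f, ContinuousMap.coeFn_toLp (p := 2) (𝕜 := 𝕜) (sigma d)
    (∑ j ∈ Finset.range (β + 1), (eigval d β j : 𝕜) •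
        ∑ i, inner 𝕜 (harmonicLp 𝕜 d j i) f • coeMap 𝕜 (harmonicBasis d j i))] with x h1 h2
  rw [h1, h2, kernelInt_eq_sum hd β (integrable_coe f)]
  simp [integral_reproKernel_mul_eq_sum (by omega : 1 ≤ d), ContinuousMap.sum_apply, coeMap,
    RCLike.real_smul_eq_coe_mul]

/-- The finite-dimensional span of the spherical harmonics of order at most `β` in `L²`. -/
noncomputable def harmonicSpan (𝕜 : Type*) [RCLike 𝕜] (d β : ℕ) : Submodule 𝕜 (Lp 𝕜 2 (sigma d)) :=
  ⨆ j : Fin (β + 1), Submodule.span 𝕜 (Set.range (harmonicLp 𝕜 d j))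

instance (d β : ℕ) : FiniteDimensional 𝕜 (harmonicSpan 𝕜 d β) := by
  have : ∀ j : Fin (β + 1), FiniteDimensional 𝕜 (Submodule.span 𝕜 (Set.range (harmonicLp 𝕜 d j))) :=
    fun j => FiniteDimensional.span_of_finite 𝕜 (Set.finite_range _)
  exact Submodule.finiteDimensional_iSup _

lemma opK_mem_harmonicSpan (hd : 2 ≤ d) (β : ℕ) (f : Lp 𝕜 2 (sigma d)) :
    opK 𝕜 d β f ∈ harmonicSpan 𝕜 d β := by
  rw [opK_eq_sum hd]
  refine Submodule.sum_mem _ fun j hj => Submodule.smul_mem _ _ (Submodule.sum_mem _ fun i _ =>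
    Submodule.smul_mem _ _ ?_)
  exact Submodule.mem_iSup_of_mem ⟨j, Finset.mem_range.1 hj⟩ (Submodule.subset_span ⟨i, rfl⟩)

lemma aeval_opK_harmonicLp (hd : 2 ≤ d) (β k : ℕ) (i : Fin (nu d k)) (q : 𝕜[X]) :
    (Polynomial.aeval (opK 𝕜 d β) q) (harmonicLp 𝕜 d k i)
      = q.eval (eigval d β k : 𝕜) • harmonicLp 𝕜 d k i := by
  induction q using Polynomial.induction_on' with
  | add p q hp hq => simp [hp, hq, add_smul]
  | monomial n a =>
    rw [Polynomial.aeval_monomial, Polynomial.eval_monomial]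
    induction n with
    | zero => simp
    | succ n ih =>
      rw [pow_succ, ← mul_assoc, mul_apply_eq_comp, opK_harmonicLp hd, map_smul, ih,
        smul_smul]
      congr 1
      ring

/-- `K_β` is annihilated by the product of `X` and of the factors `X - λ_j`, `j ≤ β`. -/
lemma aeval_opK_prod (hd : 2 ≤ d) (β : ℕ) :
    Polynomial.aeval (opK 𝕜 d β) ((∏ j ∈ Finset.range (β + 1),
      (Polynomial.X - Polynomial.C (eigval d β j : 𝕜))) * Polynomial.X) = 0 := by
  set q : 𝕜[X] := ∏ j ∈ Finset.range (β + 1),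
    (Polynomial.X - Polynomial.C (eigval d β j : 𝕜)) with hq
  have hle : harmonicSpan 𝕜 d β ≤ LinearMap.ker (Polynomial.aeval (opK 𝕜 d β) q).toLinearMap := by
    refine iSup_le fun j => Submodule.span_le.2 ?_
    rintro _ ⟨i, rfl⟩
    have h0 : q.eval (eigval d β j : 𝕜) = 0 := by
      rw [hq, Polynomial.eval_prod]
      exact Finset.prod_eq_zero (Finset.mem_range.2 j.2) (by simp)
    change (Polynomial.aeval (opK 𝕜 d β) q) (harmonicLp 𝕜 d j i) = 0
    rw [aeval_opK_harmonicLp hd, h0, zero_smul]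
  refine ContinuousLinearMap.ext fun f => ?_
  rw [map_mul, Polynomial.aeval_X, mul_apply_eq_comp]
  exact hle (opK_mem_harmonicSpan hd β f)

/-- Every `λ_k`, including the vanishing ones, has the zonal harmonic of order `k` as an
eigenfunction. -/
lemma exists_ne_zero_opK_eq (hd : 2 ≤ d) (β k : ℕ) : ∃ f : Lp 𝕜 2 (sigma d), f ≠ 0 ∧
    opK 𝕜 d β f = (eigval d β k : 𝕜) • f := by
  refine ⟨_, ?_, opK_toLp hd β k (zonalHarmonic_mem (by omega) k (pole (by omega)))⟩
  intro h
  rw [← map_zero (ContinuousMap.toLp 2 (sigma d) 𝕜)] at h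
  exact zonalHarmonic_pole_ne_zero hd k
    (ContinuousMap.toLp_injective (p := 2) (𝕜 := 𝕜) (sigma d) h)

lemma hasEigenvalue_opK (hd : 2 ≤ d) (β k : ℕ) :
    Module.End.HasEigenvalue (opK 𝕜 d β).toLinearMap (eigval d β k : 𝕜) := by
  obtain ⟨f, hf, h⟩ := exists_ne_zero_opK_eq (𝕜 := 𝕜) hd β k
  exact Module.End.hasEigenvalue_of_hasEigenvector ⟨Module.End.mem_eigenspace_iff.2 h, hf⟩

lemma eigval_mem_spectrum_opK (hd : 2 ≤ d) (β k : ℕ) :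
    (eigval d β k : 𝕜) ∈ spectrum 𝕜 (opK 𝕜 d β) := by
  obtain ⟨f, hf, h⟩ := exists_ne_zero_opK_eq (𝕜 := 𝕜) hd β k
  rw [spectrum.mem_iff]
  rintro ⟨u, hu⟩
  have h0 : (u : Lp 𝕜 2 (sigma d) →L[𝕜] Lp 𝕜 2 (sigma d)) f = 0 := by
    rw [hu, Algebra.algebraMap_eq_smul_one]
    simp [h]
  refine hf ?_
  have h1 : ((u⁻¹ : (Lp 𝕜 2 (sigma d) →L[𝕜] Lp 𝕜 2 (sigma d))ˣ) :
      Lp 𝕜 2 (sigma d) →L[𝕜] Lp 𝕜 2 (sigma d)) (u.1 f) = f := by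
    rw [← mul_apply_eq_comp, u.inv_mul]
    rfl
  rw [← h1, h0, map_zero]

lemma spectrum_opK (hd : 2 ≤ d) (β : ℕ) :
    spectrum 𝕜 (opK 𝕜 d β)
      = {0} ∪ {z : 𝕜 | ∃ k : ℕ, 0 < k ∧ k ≤ β ∧ z = (eigval d β k : 𝕜)} := by
  have h00 : eigval d β 0 = 0 := if_neg (by omega)
  refine Set.Subset.antisymm (fun z hz => ?_) ?_
  · obtain ⟨f, hf, -⟩ := exists_ne_zero_opK_eq (𝕜 := 𝕜) hd β 0
    have : Nontrivial (Lp 𝕜 2 (sigma d)) := ⟨⟨f, 0, hf⟩⟩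
    -- by the spectral mapping theorem, a spectral value is a root of the annihilating polynomial
    have h := spectrum.subset_polynomial_aeval (opK 𝕜 d β) ((∏ j ∈ Finset.range (β + 1),
      (Polynomial.X - Polynomial.C (eigval d β j : 𝕜))) * Polynomial.X) ⟨z, hz, rfl⟩
    simp only at h
    rw [aeval_opK_prod hd β, spectrum.zero_eq, Set.mem_singleton_iff, Polynomial.eval_mul,
      Polynomial.eval_X, Polynomial.eval_prod, mul_eq_zero, Finset.prod_eq_zero_iff] at h
    rcases h with ⟨j, hj, h⟩ | h
    · simp only [Polynomial.eval_sub, Polynomial.eval_X, Polynomial.eval_C, sub_eq_zero] at h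
      rcases Nat.eq_zero_or_pos j with rfl | hj0
      · left; rw [h, h00]; simp
      · exact Or.inr ⟨j, hj0, by have := Finset.mem_range.1 hj; omega, h⟩
    · exact Or.inl h
  · rintro z (rfl | ⟨k, -, -, rfl⟩)
    · simpa [h00] using eigval_mem_spectrum_opK (𝕜 := 𝕜) hd β 0
    · exact eigval_mem_spectrum_opK hd β k

lemma inner_opK_self (hd : 2 ≤ d) (β : ℕ) (f : Lp 𝕜 2 (sigma d)) :
    inner 𝕜 (opK 𝕜 d β f) f = ((∑ j ∈ Finset.range (β + 1), eigval d β j *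
      ∑ i, ‖inner 𝕜 (harmonicLp 𝕜 d j i) f‖ ^ 2 : ℝ) : 𝕜) := by
  rw [opK_eq_sum hd, sum_inner]
  push_cast
  refine Finset.sum_congr rfl fun j _ => ?_
  rw [inner_smul_left, RCLike.conj_ofReal, sum_inner]
  congr 1
  refine Finset.sum_congr rfl fun i _ => ?_
  rw [inner_smul_left, RCLike.conj_mul]

lemma eigval_nonneg (d β k : ℕ) : 0 ≤ eigval d β k := by
  unfold eigval
  split_ifs <;> positivity

end Spectral

end SphereKernel

theorem mainTheorem5 {𝕜 : Type*} [RCLike 𝕜] (d β : ℕ) (hd : 2 ≤ d) (hβ : 1 ≤ β) :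
    -- `K_β φ = λ_k φ` for every spherical harmonic `φ` of order `k`, pointwise and in `L²`
    (∀ k : ℕ, ∀ φ ∈ SphereKernel.sphericalHarmonics 𝕜 d k,
      (∀ x : SphereKernel.Sph d,
        SphereKernel.kernelInt d β φ x = (SphereKernel.eigval d β k : 𝕜) * φ x) ∧
      SphereKernel.opK 𝕜 d β (ContinuousMap.toLp 2 (SphereKernel.sigma d) 𝕜 φ) =
        (SphereKernel.eigval d β k : 𝕜) •
          ContinuousMap.toLp 2 (SphereKernel.sigma d) 𝕜 φ) ∧
    -- `K_β` has finite rank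
    FiniteDimensional 𝕜 (LinearMap.range (SphereKernel.opK 𝕜 d β).toLinearMap) ∧
    -- every `λ_k` is an eigenvalue, and the spectrum consists of `0` and the `λ_k`, `0 < k ≤ β`
    (∀ k : ℕ, Module.End.HasEigenvalue (SphereKernel.opK 𝕜 d β).toLinearMap
      (SphereKernel.eigval d β k : 𝕜)) ∧
    spectrum 𝕜 (SphereKernel.opK 𝕜 d β) =
      {0} ∪ {z : 𝕜 | ∃ k : ℕ, 0 < k ∧ k ≤ β ∧ z = (SphereKernel.eigval d β k : 𝕜)} ∧
    -- `⟨K_β f, f⟩` is real and nonnegative for every `f`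
    (∀ f : MeasureTheory.Lp 𝕜 2 (SphereKernel.sigma d),
      0 ≤ RCLike.re (inner 𝕜 (SphereKernel.opK 𝕜 d β f) f) ∧
        RCLike.im (inner 𝕜 (SphereKernel.opK 𝕜 d β f) f) = 0) := by
  refine ⟨fun k φ hφ => ⟨SphereKernel.kernelInt_sphericalHarmonic hd β k hφ,
    SphereKernel.opK_toLp hd β k hφ⟩, ?_, SphereKernel.hasEigenvalue_opK hd β,
    SphereKernel.spectrum_opK hd β, fun f => ?_⟩
  · refine Submodule.finiteDimensional_of_le (S₂ := SphereKernel.harmonicSpan 𝕜 d β) ?_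
    rintro _ ⟨f, rfl⟩
    exact SphereKernel.opK_mem_harmonicSpan hd β f
  · rw [SphereKernel.inner_opK_self hd, RCLike.ofReal_re, RCLike.ofReal_im]
    exact ⟨Finset.sum_nonneg fun j _ => mul_nonneg (SphereKernel.eigval_nonneg d β j)
      (Finset.sum_nonneg fun i _ => sq_nonneg _), rfl⟩
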